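/- **Conventions.** A *curve* is a differentiable function $f:[a,b]\to\mathbb C$, $a<b$, whose derivative is absolutely continuous and nowhere zero. Its length is $\int_a^b|f'|$, and $[f]$ denotes its reparametrization by arclength; two curves are *equivalent*, $f\equiv g$, if $[f]=[g]$. Let $\kappa$ be the signed curvature of $f$ and $ds=|f'|\,dt$. The *bending energy* of $f$ is $\frac14\int\kappa^2\,ds\in[0,\infty]$ and its *turning angle* is $\int\kappa\,ds$. A *c-curve* is a curve with $\kappa\ge0$ almost everywhere (left) or $\kappa\le 0$ almost everywhere (right) whose turning angle has magnitude at most $\pi$. An *s-curve* is a c-curve, or a curve composed of two successive c-curves that turn in opposite directions (one left, one right, in either order). For $u=(u_1,u_2)$, $v=(v_1,v_2)\in\mathbb C^2$ with $|u_2|=|v_2|=1$, $S(u,v)$ is the set of all s-curves $f:[a,b]\to\mathbb C$ with $(f(a),f'(a)/|f'(a)|)=u$ and $(f(b),f'(b)/|f'(b)|)=v$. A curve $g$ is *directly similar* to $f$ if $g\equiv c_1f+c_2$ for some $c_1,c_2\in\mathbb C$ with $c_1\ne0$. *Rectangular elastica* is $E(t)=\sin t+i\,\xi(t)$, where $\xi(t)=\int_0^t\frac{\sin^2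 r}{\sqrt{1+\sin^2 r}}\,dr$, and $E_{[t_1,t_2]}$ is its restriction to $[t_1,t_2]$. Finally, for real $\alpha,\beta,\gamma$ put $$y_1(\gamma)=\tfrac12\int_0^{\alpha-\gamma}\sqrt{\sin\tau}\,d\tau,\qquad y_2(\gamma)=\tfrac12\int_0^{\beta-\gamma}\sqrt{\sin\tau}\,d\tau,$$ $$\sigma(\gamma)=\cos\gamma+\frac{\sin\gamma}{y_1(\gamma)+y_2(\gamma)}\left(\sqrt{\sin(\alpha-\gamma)}+\sqrt{\sin(\beta-\gamma)}\right),$$ used here only at $\gamma=\beta$. **Theorem 6.2.** Let $\alpha\in(0,\pi)$ and $\beta<0$ satisfy $|\beta|\le\alpha$ and $\beta>\alpha-\pi$, put $u=(0,e^{i\alpha})$ and $v=(1,e^{i\beta})$, and suppose $\sigma(\beta)\le0$. Then there exist $-\pi<t_1<t_2\le0$ and a curve $f\in S(u,v)$ such that $E_{[t_1,t_2]}$ is directly similar to $f$, $f$ has minimal bending energy in $S(u,v)$, and every curve in $S(u,v)$ of minimal bending energy is equivalent to $f$. -/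

import Mathlib

open Set MeasureTheory

noncomputable section

namespace ElasticSpline

/-- A parametrized arc in the complex plane: an interval `[a, b]` and a function, of which only the
values on `[a, b]` matter. It is a curve when `IsCurve` below holds. -/
structure Arc where
  a : ℝ
  b : ℝ
  toFun : ℝ → ℂ

namespace Arc

/-- The derivative `f'`, taken relative to `[a, b]` (one-sided at the end points). -/
def d1 (f : Arc) : ℝ → ℂ := derivWithin f.toFun (Icc f.a f.b)

/-- The second derivative `f''` relative to `[a, b]`; for a curve it exists almost everywhere. -/
def d2 (f : Arc) : ℝ → ℂ := derivWithin f.d1 (Icc f.a f.b)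

/-- A curve is a differentiable function on `[a, b]` with absolutely continuous, nowhere vanishing
derivative. -/
structure IsCurve (f : Arc) : Prop where
  lt : f.a < f.b
  differentiableOn : DifferentiableOn ℝ f.toFun (Icc f.a f.b)
  absolutelyContinuous : AbsolutelyContinuousOnInterval f.d1 f.a f.b
  d1_ne_zero : ∀ t ∈ Icc f.a f.b, f.d1 t ≠ 0

/-- The arclength `∫_a^t |f'|` from the initial point to the point with parameter `t`. -/
def arclength (f : Arc) (t : ℝ) : ℝ := ∫ r in f.a..t, ‖f.d1 r‖

/-- The length of `f`. -/
def len (f : Arc) : ℝ := f.arclength f.b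

/-- The unit speed curve `[f]` described by `f`, defined on `[0, len f]`: its value at `s` is `f t`
for the parameter `t ∈ [a, b]` with arclength `s`. -/
def unitSpeed (f : Arc) (s : ℝ) : ℂ :=
  f.toFun (Function.invFunOn f.arclength (Icc f.a f.b) s)

/-- Two curves are equivalent if they describe the same unit speed curve. -/
def Equivalent (f g : Arc) : Prop :=
  f.len = g.len ∧ EqOn f.unitSpeed g.unitSpeed (Icc 0 f.len)

/-- The signed curvature `Im (conj f' * f'') / |f'|^3` at the parameter `t`, that is, the derivative
of the direction angle with respect to arclength (see `curvature_mul_speed`). -/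
def curvature (f : Arc) (t : ℝ) : ℝ :=
  ((starRingEnd ℂ) (f.d1 t) * f.d2 t).im / ‖f.d1 t‖ ^ 3

/-- If `τ` is a direction angle of `f`, that is, `f' = |f'| e^{iτ}`, then `κ ds/dt = dτ/dt`. -/
theorem curvature_mul_speed {f : Arc} (hf : f.IsCurve) {τ : ℝ → ℝ}
    (hdir : ∀ s ∈ Icc f.a f.b, f.d1 s = ‖f.d1 s‖ * Complex.exp (τ s * Complex.I))
    {t : ℝ} (ht : t ∈ Icc f.a f.b) (h1 : DifferentiableWithinAt ℝ f.d1 (Icc f.a f.b) t)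
    (hτ : DifferentiableWithinAt ℝ τ (Icc f.a f.b) t) :
    f.curvature t * ‖f.d1 t‖ = derivWithin τ (Icc f.a f.b) t := by
  have hu := uniqueDiffOn_Icc hf.lt t ht
  have hn : ‖f.d1 t‖ ≠ 0 := norm_ne_zero_iff.mpr (hf.d1_ne_zero t ht)
  have hD1 : HasDerivWithinAt f.d1 (f.d2 t) (Icc f.a f.b) t := h1.hasDerivWithinAt
  have hDτ := hτ.hasDerivWithinAt
  have hE := ((hDτ.ofReal_comp.neg.mul_const Complex.I).cexp)
  have hv := hD1.mul hE
  have him := (Complex.imCLM.hasFDerivAt.comp_hasDerivWithinAt t hv)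
  have hcancel : ∀ s, Complex.exp (τ s * Complex.I) * Complex.exp (-(τ s : ℂ) * Complex.I) = 1 := by
    intro s
    rw [← Complex.exp_add]
    simp
  have h0 : HasDerivWithinAt (fun _ : ℝ => (0 : ℝ)) 0 (Icc f.a f.b) t :=
    hasDerivWithinAt_const _ _ _
  have him0 := h0.congr_of_mem
    (f₁ := Complex.imCLM ∘ (f.d1 * fun x => Complex.exp (-(τ x : ℂ) * Complex.I)))
    (fun s hs => by
      simp only [Function.comp, Pi.mul_apply, Complex.imCLM_apply]
      rw [hdir s hs, mul_assoc, hcancel]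
      simp) ht
  have key := hu.eq_deriv _ him him0
  have hc : (starRingEnd ℂ) (f.d1 t) = ‖f.d1 t‖ * Complex.exp (-(τ t : ℂ) * Complex.I) := by
    conv_lhs => rw [hdir t ht]
    rw [map_mul, ← Complex.exp_conj]
    simp
  set n := ‖f.d1 t‖ with hndef
  set e := Complex.exp (-(τ t : ℂ) * Complex.I) with he
  set τ' := derivWithin τ (Icc f.a f.b) t
  have h3 : f.d1 t * e = n := by
    rw [hdir t ht, mul_assoc, hcancel]
    simp [hndef]
  have key2 : (f.d2 t * e).im = τ' * n := by
    have h4 : f.d1 t * (e * (-(τ' : ℂ) * Complex.I)) = n * (-(τ' : ℂ) * Complex.I) := by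
      rw [← mul_assoc, h3]
    have key' : (f.d2 t * e + f.d1 t * (e * (-(τ' : ℂ) * Complex.I))).im = 0 := key
    rw [h4] at key'
    simp only [Complex.add_im, Complex.mul_im, Complex.mul_re, Complex.neg_re, Complex.neg_im,
      Complex.ofReal_re, Complex.ofReal_im, Complex.I_re, Complex.I_im] at key' ⊢
    linarith
  have h5 : ((starRingEnd ℂ) (f.d1 t) * f.d2 t).im = n * (τ' * n) := by
    rw [hc, ← key2, mul_assoc, mul_comm e, Complex.im_ofReal_mul]
  unfold curvature
  rw [h5, ← hndef]
  field_simp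

/-- The turning angle `Δ(f) = ∫ κ ds`. -/
def turning (f : Arc) : ℝ := ∫ t in f.a..f.b, f.curvature t * ‖f.d1 t‖

/-- The bending energy `‖f‖² = (1/4) ∫ κ² ds`, possibly infinite. -/
def energy (f : Arc) : ENNReal :=
  (1 / 4) * ∫⁻ t in Icc f.a f.b, ENNReal.ofReal (f.curvature t ^ 2 * ‖f.d1 t‖)

/-- A left-curve has nonnegative signed curvature almost everywhere. -/
def IsLeft (f : Arc) : Prop := ∀ᵐ t ∂volume.restrict (Icc f.a f.b), 0 ≤ f.curvature t

/-- A right-curve has nonpositive signed curvature almost everywhere. -/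
def IsRight (f : Arc) : Prop := ∀ᵐ t ∂volume.restrict (Icc f.a f.b), f.curvature t ≤ 0

/-- A left c-curve: a left-curve with turning angle of magnitude at most `π`. -/
def IsLeftC (f : Arc) : Prop := f.IsCurve ∧ f.IsLeft ∧ |f.turning| ≤ Real.pi

/-- A right c-curve: a right-curve with turning angle of magnitude at most `π`. -/
def IsRightC (f : Arc) : Prop := f.IsCurve ∧ f.IsRight ∧ |f.turning| ≤ Real.pi

/-- The sub-curve of `f` over the parameter interval `[c, d]`. -/
def sub (f : Arc) (c d : ℝ) : Arc := ⟨c, d, f.toFun⟩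

/-- An s-curve is a c-curve, or a curve that consists of two c-curves which turn in opposite
directions. -/
def IsSCurve (f : Arc) : Prop :=
  f.IsCurve ∧ (f.IsLeftC ∨ f.IsRightC ∨ ∃ c ∈ Ioo f.a f.b,
    ((f.sub f.a c).IsLeftC ∧ (f.sub c f.b).IsRightC) ∨
    ((f.sub f.a c).IsRightC ∧ (f.sub c f.b).IsLeftC))

/-- The unit tangent vector (position and direction) to `f` at the parameter `t`. -/
def tangent (f : Arc) (t : ℝ) : ℂ × ℂ := (f.toFun t, f.d1 t / ‖f.d1 t‖)

/-- The image of `f` under the orientation preserving similarity `z ↦ c₁ z + c₂`. -/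
def similarityMap (f : Arc) (c₁ c₂ : ℂ) : Arc := ⟨f.a, f.b, fun t => c₁ * f.toFun t + c₂⟩

/-- `g` is directly similar to `f`: it is equivalent to the image of `f` under an orientation
preserving similarity. -/
def DirectlySimilar (g f : Arc) : Prop :=
  ∃ c₁ c₂ : ℂ, c₁ ≠ 0 ∧ g.Equivalent (f.similarityMap c₁ c₂)

/-- `f` has minimal bending energy in the family `S`. -/
def HasMinimalEnergy (S : Set Arc) (f : Arc) : Prop :=
  f ∈ S ∧ ∀ g ∈ S, f.energy ≤ g.energy

end Arc

/-- The set `S(u, v)` of all s-curves that connect the unit tangent vector `u` to the unit tangent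
vector `v`. -/
def sCurves (u v : ℂ × ℂ) : Set Arc :=
  {f | f.IsSCurve ∧ f.tangent f.a = u ∧ f.tangent f.b = v}

/-- `ξ' = sin² / √(1 + sin²)`, `ξ(0) = 0`. -/
def xi (t : ℝ) : ℝ := ∫ r in (0 : ℝ)..t, Real.sin r ^ 2 / √(1 + Real.sin r ^ 2)

/-- Rectangular elastica `E(t) = sin t + i ξ(t)`. -/
def elastica (t : ℝ) : ℂ := (Real.sin t : ℂ) + Complex.I * (xi t : ℂ)

/-- The segment `E_[t₁, t₂]`. -/
def elasticaSegment (t₁ t₂ : ℝ) : Arc := ⟨t₁, t₂, elastica⟩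

/-- `y₁(γ) = (1/2) ∫_0^{α-γ} √(sin τ) dτ`. -/
def y₁ (α γ : ℝ) : ℝ := (1 / 2) * ∫ τ in (0 : ℝ)..(α - γ), √(Real.sin τ)

/-- `y₂(γ) = (1/2) ∫_0^{β-γ} √(sin τ) dτ`. -/
def y₂ (β γ : ℝ) : ℝ := (1 / 2) * ∫ τ in (0 : ℝ)..(β - γ), √(Real.sin τ)

/-- The signed distance `σ(γ)`. -/
def sigma (α β γ : ℝ) : ℝ :=
  Real.cos γ + Real.sin γ / (y₁ α γ + y₂ β γ) *
    (√(Real.sin (α - γ)) + √(Real.sin (β - γ)))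

end ElasticSpline

end

/-!
If the direction angle `θ` of a curve stays in `[γ, γ + π]`, completing the square in `κ` gives
`¼ ∫ κ² ds = ∫ (κ / 2 + c √(sin (θ - γ)))² ds - c ∫ √(sin (θ - γ)) dθ - c² ∫ sin (θ - γ) ds`,
and the last two integrals depend only on the end conditions. So `¼ ∫ κ² ds` is bounded below, with
equality exactly when `κ = -2 c √(sin (θ - γ))`, an equation solved by rectangular elastica. The
two real equations that make a segment of elastica fit the end conditions determine `c` and `γ`;
`σ(β) ≤ 0` provides a solution by the intermediate value theorem. An s-curve whose angle leaves the
band `[γ, γ + π]` is compared instead with a band shifted to start or end at its extreme angle,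
which costs strictly more. For uniqueness, `θ` is decreasing along a curve of minimal energy and
thus matches it with the parameter of elastica.
-/

noncomputable section

namespace ElasticSpline

open Real

/-- The antiderivative `∫_0^x √(sin τ) dτ`, so that `y₁ α γ = Y (α - γ) / 2` and
`y₂ β γ = Y (β - γ) / 2` with `Y = sqrtSinIntegral`. -/
def sqrtSinIntegral (x : ℝ) : ℝ := ∫ τ in (0 : ℝ)..x, √(sin τ)

theorem continuous_sqrt_sin : Continuous fun x => √(sin x) := by fun_prop

theorem hasDerivAt_sqrtSinIntegral (x : ℝ) : HasDerivAt sqrtSinIntegral (√(sin x)) x :=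
  intervalIntegral.integral_hasDerivAt_right (continuous_sqrt_sin.intervalIntegrable _ _)
    continuous_sqrt_sin.stronglyMeasurable.stronglyMeasurableAtFilter
    continuous_sqrt_sin.continuousAt

theorem hasDerivAt_sqrtSinIntegral_const_sub (a x : ℝ) :
    HasDerivAt (fun x => sqrtSinIntegral (a - x)) (-√(sin (a - x))) x := by
  simpa using (hasDerivAt_sqrtSinIntegral (a - x)).comp_const_sub a x

theorem continuous_sqrtSinIntegral : Continuous sqrtSinIntegral :=
  continuous_iff_continuousAt.mpr fun x => (hasDerivAt_sqrtSinIntegral x).continuousAt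

@[simp]
theorem sqrtSinIntegral_zero : sqrtSinIntegral 0 = 0 := intervalIntegral.integral_same

theorem monotone_sqrtSinIntegral : Monotone sqrtSinIntegral :=
  monotone_of_deriv_nonneg (fun x => (hasDerivAt_sqrtSinIntegral x).differentiableAt)
    fun x => (hasDerivAt_sqrtSinIntegral x).deriv ▸ sqrt_nonneg _

theorem strictMonoOn_sqrtSinIntegral : StrictMonoOn sqrtSinIntegral (Icc 0 π) := by
  refine strictMonoOn_of_deriv_pos (convex_Icc _ _) continuous_sqrtSinIntegral.continuousOn
    fun x hx => ?_
  rw [interior_Icc] at hx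
  exact (hasDerivAt_sqrtSinIntegral x).deriv ▸ sqrt_pos.mpr (sin_pos_of_mem_Ioo hx)

theorem sqrtSinIntegral_pi_sub (x : ℝ) :
    sqrtSinIntegral (π - x) = sqrtSinIntegral π - sqrtSinIntegral x := by
  have hflip : ∫ τ in (0 : ℝ)..x, √(sin τ) = ∫ τ in (π - x)..π, √(sin τ) := by
    simpa only [sin_pi_sub, sub_zero] using
      intervalIntegral.integral_comp_sub_left (a := 0) (b := x) (fun τ => √(sin τ)) π
  rw [eq_sub_iff_add_eq, sqrtSinIntegral, sqrtSinIntegral, hflip]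
  exact intervalIntegral.integral_add_adjacent_intervals
    (continuous_sqrt_sin.intervalIntegrable _ _) (continuous_sqrt_sin.intervalIntegrable _ _)

theorem sqrt_add_le_sqrt_add_sqrt {x y : ℝ} (hx : 0 ≤ x) (hy : 0 ≤ y) : √(x + y) ≤ √x + √y := by
  refine sqrt_le_iff.mpr ⟨by positivity, ?_⟩
  rw [add_sq, sq_sqrt hx, sq_sqrt hy]
  linarith [mul_nonneg (sqrt_nonneg x) (sqrt_nonneg y)]

theorem sin_add_le_sin_add_sin {x y : ℝ} (hx : 0 ≤ sin x) (hy : 0 ≤ sin y) :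
    sin (x + y) ≤ sin x + sin y := by
  rw [sin_add]
  nlinarith [cos_le_one x, cos_le_one y]

theorem sin_sub_mul_cos_sub_sin_sub_mul_cos (a x y : ℝ) :
    sin (a - x) * cos y - sin (a - y) * cos x = cos a * sin (y - x) := by
  simp only [sin_sub]; ring

theorem sqrt_sin_sub_pos {a x : ℝ} (h₁ : a - π < x) (h₂ : x < a) : 0 < √(sin (a - x)) :=
  sqrt_pos.mpr (sin_pos_of_pos_of_lt_pi (by linarith) (by linarith))

theorem mul_le_sqrt_of_mul_le_mul {c s t u v : ℝ} (hcv : c * v ≤ √s) (hs : 0 ≤ s) (hu : 0 ≤ u)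
    (huv : u ≤ v) (hv : 0 < v) (h : s * u ≤ t * v) : c * u ≤ √t := by
  have ht : 0 ≤ t := nonneg_of_mul_nonneg_left ((mul_nonneg hs hu).trans h) hv
  have hroot : √s * u ≤ √t * v := by
    refine le_of_sq_le_sq ?_ (by positivity)
    rw [mul_pow, mul_pow, sq_sqrt hs, sq_sqrt ht]
    nlinarith [mul_le_mul_of_nonneg_right h hu,
      mul_le_mul_of_nonneg_left huv (mul_nonneg ht hv.le)]
  refine le_of_mul_le_mul_right ?_ hv
  calc c * u * v = c * v * u := by ring
    _ ≤ √s * u := by gcongr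
    _ ≤ √t * v := hroot

/-- The data `(c, γ)` that determine the elastic right c-curve from `(0, e^{iα})` to `(1, e^{iβ})`:
it has curvature `-2c √(sin (θ - γ))` where its direction angle is `θ`. The two equations express
that, in the frame rotated by `γ`, its chord is `1`. -/
structure IsMultiplier (α β γ c : ℝ) : Prop where
  α_pos : 0 < α
  β_neg : β < 0
  neg_β_le : -β ≤ α
  lt_γ : α - π < γ
  γ_le : γ ≤ β
  c_pos : 0 < c
  cos_eq : c * cos γ = √(sin (α - γ)) - √(sin (β - γ))
  sin_eq : c * -sin γ = 1 / 2 * (sqrtSinIntegral (α - γ) - sqrtSinIntegral (β - γ))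

/-- The determinant of the two equations of `IsMultiplier`: they have a common solution `c` if and
only if it vanishes. -/
def multiplierDefect (α β γ : ℝ) : ℝ :=
  cos γ * (1 / 2 * (sqrtSinIntegral (α - γ) - sqrtSinIntegral (β - γ))) +
    sin γ * (√(sin (α - γ)) - √(sin (β - γ)))

theorem continuous_multiplierDefect (α β : ℝ) : Continuous (multiplierDefect α β) := by
  have := continuous_sqrtSinIntegral
  unfold multiplierDefect
  fun_prop

theorem multiplierDefect_self (α β : ℝ) : multiplierDefect α β β =
    cos β * (1 / 2 * sqrtSinIntegral (α - β)) + sin β * √(sin (α - β)) := by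
  simp [multiplierDefect]

theorem multiplierDefect_sub_pi (α β : ℝ) : multiplierDefect α β (α - π) =
    -cos α * (1 / 2 * sqrtSinIntegral (α - β)) + sin α * √(sin (α - β)) := by
  have hα : α - (α - π) = π := by ring
  have hβ : β - (α - π) = π - (α - β) := by ring
  simp only [multiplierDefect, hα, hβ, sqrtSinIntegral_pi_sub, sin_pi_sub, sin_pi, sqrt_zero,
    cos_sub_pi, sin_sub_pi]
  ring

theorem isMultiplier_of_multiplierDefect_eq_zero {α β γ : ℝ} (hβ : β < 0) (hβα : -β ≤ α)
    (hγ : α - π < γ) (hγβ : γ ≤ β) (h : multiplierDefect α β γ = 0) :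
    IsMultiplier α β γ
      (1 / 2 * (sqrtSinIntegral (α - γ) - sqrtSinIntegral (β - γ)) / -sin γ) := by
  have hsin : 0 < -sin γ :=
    sin_neg γ ▸ sin_pos_of_pos_of_lt_pi (by linarith) (by linarith)
  have hY : 0 < sqrtSinIntegral (α - γ) - sqrtSinIntegral (β - γ) :=
    sub_pos.mpr (strictMonoOn_sqrtSinIntegral ⟨by linarith, by linarith⟩
      ⟨by linarith, by linarith⟩ (by linarith))
  refine ⟨by linarith, hβ, hβα, hγ, hγβ, by positivity, ?_, div_mul_cancel₀ _ hsin.ne'⟩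
  rw [div_mul_eq_mul_div, div_eq_iff hsin.ne']
  rw [multiplierDefect] at h
  linarith

section

variable {α β : ℝ} (hβ : β < 0) (hβα : -β ≤ α) (hαβ : α - π < β)
include hβ hβα hαβ

theorem sqrtSinIntegral_sub_pos : 0 < sqrtSinIntegral (α - β) := by
  simpa using strictMonoOn_sqrtSinIntegral ⟨le_rfl, pi_pos.le⟩
    (⟨by linarith, by linarith⟩ : α - β ∈ Icc 0 π) (by linarith)

theorem multiplierDefect_self_nonpos (hσ : sigma α β β ≤ 0) : multiplierDefect α β β ≤ 0 := by
  have hY := sqrtSinIntegral_sub_pos hβ hβα hαβ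
  have hfactor : multiplierDefect α β β = sigma α β β * (1 / 2 * sqrtSinIntegral (α - β)) := by
    have hσβ : sigma α β β =
        cos β + sin β / (1 / 2 * sqrtSinIntegral (α - β)) * √(sin (α - β)) := by
      simp [sigma, y₁, y₂, sqrtSinIntegral]
    rw [multiplierDefect_self, hσβ]
    field_simp
  exact hfactor ▸ mul_nonpos_of_nonpos_of_nonneg hσ (by positivity)

theorem multiplierDefect_sub_pi_pos (hα : α < π) (h : multiplierDefect α β β < 0) :
    0 < multiplierDefect α β (α - π) := by
  have hY := sqrtSinIntegral_sub_pos hβ hβα hαβ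
  have hs : 0 < √(sin (α - β)) := sqrt_sin_sub_pos (by linarith) (by linarith)
  have hsinα : 0 < sin α := sin_pos_of_pos_of_lt_pi (by linarith) hα
  rw [multiplierDefect_sub_pi]
  rcases le_or_gt (π / 2) α with hα₂ | hα₂
  · have : cos α ≤ 0 := cos_nonpos_of_pi_div_two_le_of_le hα₂ (by linarith)
    nlinarith [mul_pos hsinα hs]
  · have hsin : sin (-β) ≤ sin α :=
      sin_le_sin_of_le_of_le_pi_div_two (by linarith) hα₂.le hβα
    have hcos : cos α ≤ cos (-β) := cos_le_cos_of_nonneg_of_le_pi (by linarith) hα.le hβα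
    rw [multiplierDefect_self, ← neg_neg β, sin_neg (-β), cos_neg (-β), neg_neg] at h
    nlinarith

theorem exists_isMultiplier (hα : α < π) (hσ : sigma α β β ≤ 0) :
    ∃ γ c, IsMultiplier α β γ c := by
  obtain ⟨γ, hγ, hγβ, h⟩ : ∃ γ, α - π < γ ∧ γ ≤ β ∧ multiplierDefect α β γ = 0 := by
    rcases (multiplierDefect_self_nonpos hβ hβα hαβ hσ).eq_or_lt with h | h
    · exact ⟨β, hαβ, le_rfl, h⟩
    · obtain ⟨γ, hγ, h₀⟩ := intermediate_value_Ioo' hαβ.le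
        (continuous_multiplierDefect α β).continuousOn
        ⟨h, multiplierDefect_sub_pi_pos hβ hβα hαβ hα h⟩
      exact ⟨γ, hγ.1, hγ.2.le, h₀⟩
  exact ⟨γ, _, isMultiplier_of_multiplierDefect_eq_zero hβ hβα hγ hγβ h⟩

end

/-- The bending energy of the elastic curve with the data `(c, γ)` of `IsMultiplier α β γ c`. -/
def multiplierEnergy (α β γ c : ℝ) : ℝ :=
  c * (sqrtSinIntegral (α - γ) - sqrtSinIntegral (β - γ) + c * sin γ)

namespace IsMultiplier

variable {α β γ c x : ℝ} (h : IsMultiplier α β γ c)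
include h

theorem neg_pi_div_two_lt_β : -(π / 2) < β := by linarith [h.neg_β_le, h.lt_γ, h.γ_le]

theorem mul_cos_lt (hx₁ : α - π < x) (hx₂ : x < γ) :
    c * cos x < √(sin (α - x)) + √(sin (β - x)) := by
  obtain ⟨hα, hβ, _, _, hγβ, hc, hcos, -⟩ := h
  have hsα : 0 < √(sin (α - x)) := sqrt_sin_sub_pos hx₁ (by linarith)
  have hsβ : 0 < √(sin (β - x)) := sqrt_sin_sub_pos (by linarith) (by linarith)
  rcases le_or_gt (cos x) 0 with hx | hx
  · linarith [mul_nonpos_of_nonneg_of_nonpos hc.le hx]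
  have hxγ : cos x < cos γ := by
    rw [← cos_neg x, ← cos_neg γ]
    exact cos_lt_cos_of_nonneg_of_le_pi (by linarith) (by linarith) (by linarith)
  have hle : c * cos γ ≤ √(sin (α - γ)) := hcos ▸ sub_le_self _ (sqrt_nonneg _)
  rcases le_or_gt (π / 2) α with hα₂ | hα₂
  · have hanti : sin (α - γ) ≤ sin (α - β) := by
      rw [← sin_pi_sub (α - γ), ← sin_pi_sub (α - β)]
      exact sin_le_sin_of_le_of_le_pi_div_two (by linarith) (by linarith) (by linarith)
    have hadd : sin (α - β) ≤ sin (α - x) + sin (β - x) := by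
      rw [← sin_pi_sub (α - β), ← sin_pi_sub (α - x),
        show π - (α - β) = π - (α - x) + (β - x) by ring]
      exact sin_add_le_sin_add_sin (sin_pi_sub (α - x) ▸ (sqrt_pos.mp hsα).le) (sqrt_pos.mp hsβ).le
    calc c * cos x < c * cos γ := by gcongr
      _ ≤ √(sin (α - γ)) := hle
      _ ≤ √(sin (α - x) + sin (β - x)) := sqrt_le_sqrt (hanti.trans hadd)
      _ ≤ _ := sqrt_add_le_sqrt_add_sqrt (sqrt_pos.mp hsα).le (sqrt_pos.mp hsβ).le
  · have hcross : sin (α - γ) * cos x ≤ sin (α - x) * cos γ := by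
      rw [← sub_nonneg, sin_sub_mul_cos_sub_sin_sub_mul_cos]
      exact mul_nonneg (cos_nonneg_of_mem_Icc ⟨by linarith, by linarith⟩)
        (sin_nonneg_of_nonneg_of_le_pi (by linarith) (by linarith))
    exact lt_add_of_le_of_pos (mul_le_sqrt_of_mul_le_mul hle
      (sin_nonneg_of_nonneg_of_le_pi (by linarith) (by linarith)) hx.le hxγ.le (hx.trans hxγ)
      hcross) hsβ

theorem neg_mul_cos_lt (hx₁ : γ < x) (hx₂ : x < β) :
    c * -cos x < √(sin (α - x)) + √(sin (β - x)) := by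
  have hβ₂ := h.neg_pi_div_two_lt_β
  obtain ⟨hα, hβ, _, hγ, _, hc, hcos, -⟩ := h
  have hsα : 0 < √(sin (α - x)) := sqrt_sin_sub_pos (by linarith) (by linarith)
  have hsβ : 0 < √(sin (β - x)) := sqrt_sin_sub_pos (by linarith) hx₂
  rcases le_or_gt 0 (cos x) with hx | hx
  · linarith [mul_nonneg hc.le hx]
  have hxγ : -cos x < -cos γ := by
    rw [← cos_neg x, ← cos_neg γ, neg_lt_neg_iff]
    exact cos_lt_cos_of_nonneg_of_le_pi (by linarith) (by linarith) (by linarith)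
  have hle : c * -cos γ ≤ √(sin (β - γ)) := by
    linarith [sqrt_nonneg (sin (α - γ))]
  have hcross : sin (β - γ) * -cos x ≤ sin (β - x) * -cos γ := by
    have hdet := sin_sub_mul_cos_sub_sin_sub_mul_cos β γ x
    have : 0 ≤ cos β * sin (x - γ) := mul_nonneg (cos_nonneg_of_mem_Icc ⟨hβ₂.le, by linarith⟩)
      (sin_nonneg_of_nonneg_of_le_pi (by linarith) (by linarith))
    linarith
  exact lt_add_of_pos_of_le hsα (mul_le_sqrt_of_mul_le_mul hle
    (sin_nonneg_of_nonneg_of_le_pi (by linarith) (by linarith)) (by linarith) hxγ.le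
    (by linarith) hcross)

theorem lt_of_turning_below (hx₁ : α - π ≤ x) (hx₂ : x < γ) :
    sqrtSinIntegral (α - γ) - sqrtSinIntegral (β - γ) + c * sin γ <
      sqrtSinIntegral (α - x) + sqrtSinIntegral (β - x) + c * sin x := by
  set D : ℝ → ℝ := fun x => sqrtSinIntegral (α - x) + sqrtSinIntegral (β - x) + c * sin x with hD
  have hD' (x : ℝ) : HasDerivAt D (-√(sin (α - x)) + -√(sin (β - x)) + c * cos x) x :=
    ((hasDerivAt_sqrtSinIntegral_const_sub α x).add
      (hasDerivAt_sqrtSinIntegral_const_sub β x)).add ((hasDerivAt_sin x).const_mul c)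
  have hanti : StrictAntiOn D (Icc (α - π) γ) := by
    refine strictAntiOn_of_deriv_neg (convex_Icc _ _)
      (fun x _ => (hD' x).continuousAt.continuousWithinAt) fun x hx => ?_
    rw [interior_Icc] at hx
    rw [(hD' x).deriv]
    linarith [h.mul_cos_lt hx.1 hx.2]
  have hlt : D γ < D x := hanti ⟨hx₁, hx₂.le⟩ ⟨h.lt_γ.le, le_rfl⟩ hx₂
  have hβγ : 0 ≤ sqrtSinIntegral (β - γ) := by
    simpa using monotone_sqrtSinIntegral (sub_nonneg.mpr h.γ_le)
  simp only [hD] at hlt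
  linarith

theorem lt_of_turning_above (hx₁ : γ < x) (hx₂ : x ≤ β) :
    sqrtSinIntegral (α - γ) - sqrtSinIntegral (β - γ) + c * sin γ <
      2 * sqrtSinIntegral π - sqrtSinIntegral (α - x) - sqrtSinIntegral (β - x) + c * sin x := by
  set D : ℝ → ℝ := fun x =>
    c * sin x - (sqrtSinIntegral (α - x) + sqrtSinIntegral (β - x)) with hD
  have hD' (x : ℝ) : HasDerivAt D (c * cos x - (-√(sin (α - x)) + -√(sin (β - x)))) x :=
    ((hasDerivAt_sin x).const_mul c).sub ((hasDerivAt_sqrtSinIntegral_const_sub α x).add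
      (hasDerivAt_sqrtSinIntegral_const_sub β x))
  have hmono : StrictMonoOn D (Icc γ β) := by
    refine strictMonoOn_of_deriv_pos (convex_Icc _ _)
      (fun x _ => (hD' x).continuousAt.continuousWithinAt) fun x hx => ?_
    rw [interior_Icc] at hx
    rw [(hD' x).deriv]
    linarith [h.neg_mul_cos_lt hx.1 hx.2]
  have hlt : D γ < D x := hmono ⟨le_rfl, h.γ_le⟩ ⟨hx₁.le, hx₂⟩ hx₁
  have hαγ : sqrtSinIntegral (α - γ) ≤ sqrtSinIntegral π :=
    monotone_sqrtSinIntegral (by linarith [h.lt_γ])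
  simp only [hD] at hlt
  linarith

end IsMultiplier

theorem absolutelyContinuousOnInterval_comp_of_contDiff {E F : Type*} [NormedAddCommGroup E]
    [NormedSpace ℝ E] [ProperSpace E] [NormedAddCommGroup F] [NormedSpace ℝ F] {f : ℝ → E}
    {a b : ℝ} {J : E → F} (hJ : ContDiff ℝ 1 J) (hf : AbsolutelyContinuousOnInterval f a b) :
    AbsolutelyContinuousOnInterval (fun t => J (f t)) a b := by
  obtain ⟨C, hC⟩ := hf.exists_bound
  obtain ⟨K, hK⟩ := (hJ.contDiffOn (s := Metric.closedBall 0 C)).exists_lipschitzOnWith one_ne_zero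
    (convex_closedBall _ _) (isCompact_closedBall _ _)
  have hlim := Filter.Tendsto.const_mul (K : ℝ) hf
  rw [mul_zero] at hlim
  refine squeeze_zero' (.of_forall fun E => Finset.sum_nonneg fun _ _ => dist_nonneg) ?_ hlim
  filter_upwards [Filter.mem_inf_of_right (Filter.mem_principal_self _)] with E hE
  rw [Finset.mul_sum]
  exact Finset.sum_le_sum fun i hi => hK.dist_le_mul
    _ (mem_closedBall_zero_iff.mpr (hC _ (hE.1 i hi).1))
    _ (mem_closedBall_zero_iff.mpr (hC _ (hE.1 i hi).2))

theorem intervalIntegrable_deriv_of_absolutelyContinuousOnInterval {f : ℝ → ℂ} {a b : ℝ}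
    (hf : AbsolutelyContinuousOnInterval f a b) : IntervalIntegrable (deriv f) volume a b := by
  have hre := (absolutelyContinuousOnInterval_comp_of_contDiff
    Complex.reCLM.contDiff hf).intervalIntegrable_deriv
  have him := (absolutelyContinuousOnInterval_comp_of_contDiff
    Complex.imCLM.contDiff hf).intervalIntegrable_deriv
  have hsum : IntervalIntegrable (fun t => ((deriv (fun t => Complex.reCLM (f t)) t : ℝ) : ℂ) +
      (deriv (fun t => Complex.imCLM (f t)) t : ℝ) * Complex.I) volume a b :=
    .add ⟨hre.1.ofReal, hre.2.ofReal⟩ (.mul_const ⟨him.1.ofReal, him.2.ofReal⟩ _)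
  refine hsum.congr_ae ?_
  rw [Filter.EventuallyEq, ae_restrict_iff' measurableSet_uIoc]
  filter_upwards [hf.boundedVariationOn.ae_differentiableAt_of_mem_uIcc] with t ht ht'
  have hd := (ht (uIoc_subset_uIcc ht')).hasDerivAt
  have hre' : deriv (fun t => Complex.reCLM (f t)) t = (deriv f t).re :=
    (Complex.reCLM.hasFDerivAt.comp_hasDerivAt t hd).deriv
  have him' : deriv (fun t => Complex.imCLM (f t)) t = (deriv f t).im :=
    (Complex.imCLM.hasFDerivAt.comp_hasDerivAt t hd).deriv
  rw [hre', him', Complex.re_add_im]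

theorem eq_mul_exp_of_ae_hasDerivAt {a b t : ℝ} {g l L : ℝ → ℂ}
    (hg : AbsolutelyContinuousOnInterval g a b) (hL : AbsolutelyContinuousOnInterval L a b)
    (hg' : ∀ᵐ t, t ∈ uIcc a b → HasDerivAt g (g t * l t) t)
    (hL' : ∀ᵐ t, t ∈ uIcc a b → HasDerivAt L (l t) t) (ht : t ∈ uIcc a b) :
    g t = g a * Complex.exp (L t - L a) := by
  have hac : AbsolutelyContinuousOnInterval (fun t => g t * Complex.exp (-L t)) a b :=
    hg.fun_smul (absolutelyContinuousOnInterval_comp_of_contDiff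
      (J := fun z => Complex.exp (-z)) (by fun_prop) hL)
  have hzero : ∀ᵐ t, t ∈ uIcc a b → HasDerivAt (fun t => g t * Complex.exp (-L t)) 0 t := by
    filter_upwards [hg', hL'] with t hgt hLt ht
    exact ((hgt ht).mul (hLt ht).neg.cexp).congr_deriv (by ring)
  obtain ⟨C, hC⟩ := hac.const_of_ae_hasDerivAt_zero hzero
  have hconst : g t * Complex.exp (-L t) = g a * Complex.exp (-L a) :=
    (hC t ht).trans (hC a left_mem_uIcc).symm
  rw [sub_eq_neg_add, Complex.exp_add, ← mul_assoc, ← hconst, mul_assoc, ← Complex.exp_add,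
    neg_add_cancel, Complex.exp_zero, mul_one]

namespace Arc

/-- The rate `κ ds/dt` at which the direction of `f` turns. -/
def turnRate (f : Arc) (t : ℝ) : ℝ := f.curvature t * ‖f.d1 t‖

/-- The continuous direction angle of `f` whose initial value is the principal argument. -/
def angle (f : Arc) (t : ℝ) : ℝ := (f.d1 f.a).arg + ∫ r in f.a..t, f.turnRate r

theorem turnRate_eq (f : Arc) (t : ℝ) : f.turnRate t = (f.d2 t / f.d1 t).im := by
  rcases eq_or_ne (f.d1 t) 0 with h | h
  · simp [turnRate, h]
  have hn : ‖f.d1 t‖ ≠ 0 := norm_ne_zero_iff.mpr h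
  have hdiv : f.d2 t / f.d1 t =
      (starRingEnd ℂ) (f.d1 t) * f.d2 t * (((‖f.d1 t‖ ^ 2)⁻¹ : ℝ) : ℂ) := by
    rw [div_eq_mul_inv, Complex.inv_def, Complex.normSq_eq_norm_sq]
    ring
  rw [hdiv, Complex.im_mul_ofReal, turnRate, curvature]
  field_simp

theorem angle_start (f : Arc) : f.angle f.a = (f.d1 f.a).arg := by
  rw [angle, intervalIntegral.integral_same, add_zero]

namespace IsCurve

variable {f : Arc} {p q t : ℝ} (hf : f.IsCurve)
include hf

theorem left_mem : f.a ∈ Icc f.a f.b := left_mem_Icc.mpr hf.lt.le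

theorem right_mem : f.b ∈ Icc f.a f.b := right_mem_Icc.mpr hf.lt.le

theorem uIcc_subset (hp : p ∈ Icc f.a f.b) (hq : q ∈ Icc f.a f.b) : uIcc p q ⊆ uIcc f.a f.b :=
  uIcc_of_le hf.lt.le ▸ uIcc_subset_Icc hp hq

theorem continuousOn_d1 : ContinuousOn f.d1 (Icc f.a f.b) :=
  uIcc_of_le hf.lt.le ▸ hf.absolutelyContinuous.continuousOn

theorem hasDerivWithinAt (ht : t ∈ Icc f.a f.b) :
    HasDerivWithinAt f.toFun (f.d1 t) (Icc f.a f.b) t :=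
  (hf.differentiableOn t ht).hasDerivWithinAt

theorem hasDerivAt (ht : t ∈ Ioo f.a f.b) : HasDerivAt f.toFun (f.d1 t) t :=
  (hf.hasDerivWithinAt (Ioo_subset_Icc_self ht)).hasDerivAt (Icc_mem_nhds ht.1 ht.2)

theorem norm_d1_pos (ht : t ∈ Icc f.a f.b) : 0 < ‖f.d1 t‖ :=
  norm_pos_iff.mpr (hf.d1_ne_zero t ht)

theorem ae_hasDerivAt_d1 : ∀ᵐ t, t ∈ Icc f.a f.b → HasDerivAt f.d1 (f.d2 t) t := by
  filter_upwards [hf.absolutelyContinuous.boundedVariationOn.ae_differentiableAt_of_mem_uIcc]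
    with t ht ht'
  have hd := ht (by rwa [uIcc_of_le hf.lt.le])
  rw [d2, hd.derivWithin (uniqueDiffOn_Icc hf.lt t ht')]
  exact hd.hasDerivAt

theorem intervalIntegrable_d2 : IntervalIntegrable f.d2 volume f.a f.b := by
  refine (intervalIntegrable_deriv_of_absolutelyContinuousOnInterval
    hf.absolutelyContinuous).congr_ae ?_
  rw [Filter.EventuallyEq, ae_restrict_iff' measurableSet_uIoc, uIoc_of_le hf.lt.le]
  filter_upwards [hf.ae_hasDerivAt_d1] with t ht ht'
  exact (ht (Ioc_subset_Icc_self ht')).deriv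

theorem intervalIntegrable_d2_div_d1 :
    IntervalIntegrable (fun t => f.d2 t / f.d1 t) volume f.a f.b := by
  simp only [div_eq_mul_inv]
  refine hf.intervalIntegrable_d2.mul_continuousOn ?_
  rw [uIcc_of_le hf.lt.le]
  exact hf.continuousOn_d1.inv₀ hf.d1_ne_zero

theorem intervalIntegrable_turnRate_left_right :
    IntervalIntegrable f.turnRate volume f.a f.b := by
  have h := hf.intervalIntegrable_d2_div_d1
  exact IntervalIntegrable.congr (fun t _ => (f.turnRate_eq t).symm) ⟨h.1.im, h.2.im⟩

theorem intervalIntegrable_turnRate (hp : p ∈ Icc f.a f.b) (hq : q ∈ Icc f.a f.b) :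
    IntervalIntegrable f.turnRate volume p q :=
  hf.intervalIntegrable_turnRate_left_right.mono_set (hf.uIcc_subset hp hq)

theorem absolutelyContinuous_angle : AbsolutelyContinuousOnInterval f.angle f.a f.b :=
  absolutelyContinuousOnInterval_comp_of_contDiff (J := fun x => (f.d1 f.a).arg + x) (by fun_prop)
    (hf.intervalIntegrable_turnRate_left_right.absolutelyContinuousOnInterval_intervalIntegral
      left_mem_uIcc)

theorem continuousOn_angle : ContinuousOn f.angle (Icc f.a f.b) :=
  uIcc_of_le hf.lt.le ▸ hf.absolutelyContinuous_angle.continuousOn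

theorem ae_hasDerivAt_angle :
    ∀ᵐ t, t ∈ Icc f.a f.b → HasDerivAt f.angle (f.turnRate t) t := by
  filter_upwards [hf.intervalIntegrable_turnRate_left_right.ae_hasDerivAt_integral] with t h ht
  rw [← uIcc_of_le hf.lt.le] at ht
  exact (h ht f.a left_mem_uIcc).const_add _

theorem angle_sub (hp : p ∈ Icc f.a f.b) (hq : q ∈ Icc f.a f.b) :
    f.angle q - f.angle p = ∫ t in p..q, f.turnRate t := by
  rw [angle, angle, add_sub_add_left_eq_sub]
  exact intervalIntegral.integral_interval_sub_left
    (hf.intervalIntegrable_turnRate hf.left_mem hq) (hf.intervalIntegrable_turnRate hf.left_mem hp)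

theorem d1_eq_mul_exp (ht : t ∈ Icc f.a f.b) :
    f.d1 t = f.d1 f.a * Complex.exp ((∫ r in f.a..t, (f.d2 r / f.d1 r).re : ℝ) +
      (f.angle t - f.angle f.a : ℝ) * Complex.I) := by
  set ρ : ℝ → ℝ := fun t => ∫ r in f.a..t, (f.d2 r / f.d1 r).re with hρ
  have hint : IntervalIntegrable (fun t => (f.d2 t / f.d1 t).re) volume f.a f.b :=
    ⟨hf.intervalIntegrable_d2_div_d1.1.re, hf.intervalIntegrable_d2_div_d1.2.re⟩
  have hac : AbsolutelyContinuousOnInterval (fun t => (ρ t : ℂ) + f.angle t * Complex.I) f.a f.b :=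
    (absolutelyContinuousOnInterval_comp_of_contDiff Complex.ofRealCLM.contDiff
      (hint.absolutelyContinuousOnInterval_intervalIntegral left_mem_uIcc)).fun_add
    (absolutelyContinuousOnInterval_comp_of_contDiff (J := fun x : ℝ => (x : ℂ) * Complex.I)
      (Complex.ofRealCLM.contDiff.mul contDiff_const) hf.absolutelyContinuous_angle)
  have hd1 : ∀ᵐ t, t ∈ uIcc f.a f.b → HasDerivAt f.d1 (f.d1 t * (f.d2 t / f.d1 t)) t := by
    rw [uIcc_of_le hf.lt.le]
    filter_upwards [hf.ae_hasDerivAt_d1] with t h ht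
    rw [mul_div_cancel₀ _ (hf.d1_ne_zero t ht)]
    exact h ht
  have hlog : ∀ᵐ t, t ∈ uIcc f.a f.b →
      HasDerivAt (fun t => (ρ t : ℂ) + f.angle t * Complex.I) (f.d2 t / f.d1 t) t := by
    filter_upwards [hint.ae_hasDerivAt_integral, hf.ae_hasDerivAt_angle] with t hre him ht
    have hre' := (hre ht f.a left_mem_uIcc).ofReal_comp
    have him' := ((him (uIcc_of_le hf.lt.le ▸ ht)).ofReal_comp).mul_const Complex.I
    rw [turnRate_eq] at him'
    exact (hre'.add him').congr_deriv (Complex.re_add_im _)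
  rw [eq_mul_exp_of_ae_hasDerivAt hf.absolutelyContinuous hac hd1 hlog
    (uIcc_of_le hf.lt.le ▸ ht)]
  congr 2
  simp only [hρ, intervalIntegral.integral_same]
  push_cast
  ring

theorem d1_eq_norm_mul_exp_angle (ht : t ∈ Icc f.a f.b) :
    f.d1 t = ‖f.d1 t‖ * Complex.exp (f.angle t * Complex.I) := by
  have hnorm : ‖f.d1 t‖ = ‖f.d1 f.a‖ * exp (∫ r in f.a..t, (f.d2 r / f.d1 r).re) := by
    rw [hf.d1_eq_mul_exp ht, norm_mul, Complex.norm_exp]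
    simp
  rw [hnorm, Complex.ofReal_mul, Complex.ofReal_exp, mul_assoc, ← Complex.exp_add]
  nth_rw 1 [hf.d1_eq_mul_exp ht, ← Complex.norm_mul_exp_arg_mul_I (f.d1 f.a), ← f.angle_start]
  rw [mul_assoc, ← Complex.exp_add]
  congr 2
  push_cast
  ring

end IsCurve

end Arc

theorem contDiff_sqrtSinIntegral : ContDiff ℝ 1 sqrtSinIntegral := by
  have hderiv : deriv sqrtSinIntegral = fun x => √(sin x) :=
    funext fun x => (hasDerivAt_sqrtSinIntegral x).deriv
  exact contDiff_one_iff_deriv.mpr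
    ⟨fun x => (hasDerivAt_sqrtSinIntegral x).differentiableAt, hderiv ▸ continuous_sqrt_sin⟩

namespace Arc

/-- The integrand `κ² ds/dt` of four times the bending energy. -/
def bend (f : Arc) (t : ℝ) : ℝ := f.curvature t ^ 2 * ‖f.d1 t‖

theorem bend_nonneg (f : Arc) (t : ℝ) : 0 ≤ f.bend t := by unfold bend; positivity

/-- The component of `z` in the direction `i e^{iγ}`. -/
def height (γ : ℝ) (z : ℂ) : ℝ := Complex.imCLM (Complex.exp (-(γ * Complex.I)) * z)

theorem height_mul_exp (γ r θ : ℝ) :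
    height γ (r * Complex.exp (θ * Complex.I)) = r * sin (θ - γ) := by
  rw [height, mul_left_comm, ← Complex.exp_add,
    show -((γ : ℂ) * Complex.I) + θ * Complex.I = ((θ - γ : ℝ) : ℂ) * Complex.I by push_cast; ring,
    Complex.imCLM_apply, Complex.im_ofReal_mul, Complex.exp_ofReal_mul_I_im]

theorem height_one (γ : ℝ) : height γ 1 = -sin γ := by
  simpa using height_mul_exp γ 1 0

theorem height_zero (γ : ℝ) : height γ 0 = 0 := by simp [height]

theorem continuous_height (γ : ℝ) : Continuous (height γ) :=
  Complex.imCLM.continuous.comp (continuous_const.mul continuous_id)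

/-- The square that remains when the Lagrangian of the bending energy, with multipliers for the
component of the chord in the direction `i e^{iγ}`, is completed to a square plus an exact term. -/
def calibrationDefect (f : Arc) (γ c t : ℝ) : ℝ :=
  (f.curvature t / 2 + c * √(sin (f.angle t - γ))) ^ 2 * ‖f.d1 t‖

theorem calibrationDefect_nonneg (f : Arc) (γ c t : ℝ) : 0 ≤ f.calibrationDefect γ c t := by
  unfold calibrationDefect; positivity

theorem calibrationDefect_eq (f : Arc) {γ t : ℝ} (c : ℝ) (hθ : 0 ≤ sin (f.angle t - γ)) :
    f.calibrationDefect γ c t = 1 / 4 * f.bend t + c ^ 2 * (‖f.d1 t‖ * sin (f.angle t - γ)) +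
      c * (√(sin (f.angle t - γ)) * f.turnRate t) := by
  rw [calibrationDefect, add_sq, mul_pow, sq_sqrt hθ, bend, turnRate]
  ring

namespace IsCurve

variable {f : Arc} {p q : ℝ} (hf : f.IsCurve)
include hf

theorem aestronglyMeasurable_bend :
    AEStronglyMeasurable f.bend (volume.restrict (Icc f.a f.b)) := by
  have hturn : AEStronglyMeasurable f.turnRate (volume.restrict (Icc f.a f.b)) := by
    rw [← restrict_Ioc_eq_restrict_Icc]
    exact hf.intervalIntegrable_turnRate_left_right.1.aestronglyMeasurable
  have hspeed : AEStronglyMeasurable (fun t => ‖f.d1 t‖⁻¹) (volume.restrict (Icc f.a f.b)) :=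
    (hf.continuousOn_d1.norm.inv₀ fun t ht =>
      (hf.norm_d1_pos ht).ne').aestronglyMeasurable measurableSet_Icc
  refine ((hturn.pow 2).mul hspeed).congr ?_
  rw [Filter.EventuallyEq, ae_restrict_iff' measurableSet_Icc]
  refine .of_forall fun t ht => ?_
  have := hf.norm_d1_pos ht
  simp only [Pi.mul_apply, Pi.pow_apply, turnRate, bend]
  field_simp

theorem integrableOn_bend (h : f.energy ≠ ⊤) : IntegrableOn f.bend (Icc f.a f.b) := by
  refine ⟨hf.aestronglyMeasurable_bend, ?_⟩
  rw [hasFiniteIntegral_iff_ofReal (.of_forall f.bend_nonneg), lt_top_iff_ne_top]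
  exact fun htop => h (ENNReal.mul_eq_top.mpr (.inl ⟨by simp, htop⟩))

theorem energy_eq (h : IntegrableOn f.bend (Icc f.a f.b)) :
    f.energy = ENNReal.ofReal (1 / 4 * ∫ t in f.a..f.b, f.bend t) := by
  rw [ENNReal.ofReal_mul (by norm_num), intervalIntegral.integral_of_le hf.lt.le,
    ← integral_Icc_eq_integral_Ioc,
    ofReal_integral_eq_lintegral_ofReal h (.of_forall f.bend_nonneg), energy,
    ENNReal.ofReal_div_of_pos (by norm_num), ENNReal.ofReal_one, ENNReal.ofReal_ofNat]
  rfl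

theorem continuousOn_sin_angle_sub (γ : ℝ) :
    ContinuousOn (fun t => sin (f.angle t - γ)) (Icc f.a f.b) :=
  continuous_sin.comp_continuousOn (hf.continuousOn_angle.sub continuousOn_const)

section

variable (γ : ℝ) (hp : p ∈ Icc f.a f.b) (hq : q ∈ Icc f.a f.b)
include hp hq

theorem intervalIntegrable_bend (hb : IntegrableOn f.bend (Icc f.a f.b)) :
    IntervalIntegrable f.bend volume p q :=
  ((intervalIntegrable_iff_integrableOn_Icc_of_le hf.lt.le).mpr hb).mono_set
    (hf.uIcc_subset hp hq)

theorem intervalIntegrable_norm_mul_sin :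
    IntervalIntegrable (fun t => ‖f.d1 t‖ * sin (f.angle t - γ)) volume p q :=
  ((hf.continuousOn_d1.norm.mul (hf.continuousOn_sin_angle_sub γ)).mono
    (uIcc_subset_Icc hp hq)).intervalIntegrable

theorem integral_norm_mul_sin (hpq : p ≤ q) :
    ∫ t in p..q, ‖f.d1 t‖ * sin (f.angle t - γ) =
      height γ (f.toFun q) - height γ (f.toFun p) := by
  refine intervalIntegral.integral_eq_sub_of_hasDerivAt_of_le hpq
    ((continuous_height γ).comp_continuousOn (hf.differentiableOn.continuousOn.mono
      (Icc_subset_Icc hp.1 hq.2))) (fun t ht => ?_) (hf.intervalIntegrable_norm_mul_sin γ hp hq)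
  have ht' : t ∈ Ioo f.a f.b := Ioo_subset_Ioo hp.1 hq.2 ht
  rw [← height_mul_exp, ← hf.d1_eq_norm_mul_exp_angle (Ioo_subset_Icc_self ht')]
  exact Complex.imCLM.hasFDerivAt.comp_hasDerivAt t
    ((hf.hasDerivAt ht').const_mul (Complex.exp (-(γ * Complex.I))))

theorem intervalIntegrable_sqrt_sin_mul_turnRate :
    IntervalIntegrable (fun t => √(sin (f.angle t - γ)) * f.turnRate t) volume p q :=
  (hf.intervalIntegrable_turnRate hp hq).continuousOn_mul
    ((hf.continuousOn_sin_angle_sub γ).sqrt.mono (uIcc_subset_Icc hp hq))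

theorem integral_sqrt_sin_mul_turnRate :
    ∫ t in p..q, √(sin (f.angle t - γ)) * f.turnRate t =
      sqrtSinIntegral (f.angle q - γ) - sqrtSinIntegral (f.angle p - γ) := by
  have hac : AbsolutelyContinuousOnInterval (fun t => sqrtSinIntegral (f.angle t - γ)) p q :=
    (absolutelyContinuousOnInterval_comp_of_contDiff (J := fun x => sqrtSinIntegral (x - γ))
      (contDiff_sqrtSinIntegral.comp (by fun_prop)) hf.absolutelyContinuous_angle).mono
      (hf.uIcc_subset hp hq)
  rw [← hac.integral_deriv_eq_sub]
  refine intervalIntegral.integral_congr_ae ?_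
  filter_upwards [hf.ae_hasDerivAt_angle] with t ht htpq
  have hangle := ht (uIcc_subset_Icc hp hq (uIoc_subset_uIcc htpq))
  exact ((hasDerivAt_sqrtSinIntegral (f.angle t - γ)).comp t (hangle.sub_const γ)).deriv.symm

variable {γ} (hb : IntegrableOn f.bend (Icc f.a f.b)) (hpq : p ≤ q)
  (hθ : ∀ t ∈ Icc p q, 0 ≤ sin (f.angle t - γ))
include hb hpq hθ

theorem intervalIntegrable_calibrationDefect (c : ℝ) :
    IntervalIntegrable (f.calibrationDefect γ c) volume p q :=
  ((((hf.intervalIntegrable_bend hp hq hb).const_mul (1 / 4)).add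
    ((hf.intervalIntegrable_norm_mul_sin γ hp hq).const_mul (c ^ 2))).add
    ((hf.intervalIntegrable_sqrt_sin_mul_turnRate γ hp hq).const_mul c)).congr fun t ht =>
      (f.calibrationDefect_eq c (hθ t (uIcc_of_le hpq ▸ uIoc_subset_uIcc ht))).symm

theorem integral_bend_eq (c : ℝ) : 1 / 4 * ∫ t in p..q, f.bend t =
    (∫ t in p..q, f.calibrationDefect γ c t)
      - c ^ 2 * (height γ (f.toFun q) - height γ (f.toFun p))
      - c * (sqrtSinIntegral (f.angle q - γ) - sqrtSinIntegral (f.angle p - γ)) := by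
  have hbend := (hf.intervalIntegrable_bend hp hq hb).const_mul (1 / 4)
  have hchord := (hf.intervalIntegrable_norm_mul_sin γ hp hq).const_mul (c ^ 2)
  have hturn := (hf.intervalIntegrable_sqrt_sin_mul_turnRate γ hp hq).const_mul c
  rw [intervalIntegral.integral_congr fun t ht =>
      f.calibrationDefect_eq c (hθ t (uIcc_of_le hpq ▸ ht)),
    intervalIntegral.integral_add (hbend.add hchord) hturn,
    intervalIntegral.integral_add hbend hchord]
  simp only [intervalIntegral.integral_const_mul]
  rw [hf.integral_norm_mul_sin γ hp hq hpq, hf.integral_sqrt_sin_mul_turnRate γ hp hq]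
  ring

theorem le_integral_bend (c : ℝ) :
    -c ^ 2 * (height γ (f.toFun q) - height γ (f.toFun p))
      - c * (sqrtSinIntegral (f.angle q - γ) - sqrtSinIntegral (f.angle p - γ)) ≤
    1 / 4 * ∫ t in p..q, f.bend t := by
  have hnonneg : 0 ≤ ∫ t in p..q, f.calibrationDefect γ c t :=
    intervalIntegral.integral_nonneg hpq fun t _ => f.calibrationDefect_nonneg γ c t
  linarith [hf.integral_bend_eq hp hq hb hpq hθ c]

end

end IsCurve

end Arc

theorem eq_of_exp_mul_I_eq {x y : ℝ} (h : Complex.exp (x * Complex.I) = Complex.exp (y * Complex.I))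
    (hxy : |x - y| < 2 * π) : x = y := by
  have hexp : Complex.exp ((x - y : ℝ) * Complex.I) = 1 := by
    rw [Complex.ofReal_sub, sub_mul, Complex.exp_sub, h, div_self (Complex.exp_ne_zero _)]
  have hcos : cos (x - y) = 1 := by
    rw [← Complex.exp_ofReal_mul_I_re, hexp, Complex.one_re]
  exact sub_eq_zero.mp ((cos_eq_one_iff_of_lt_of_lt (abs_lt.mp hxy).1 (abs_lt.mp hxy).2).mp hcos)

theorem sin_sub_nonneg_of_mem {γ x : ℝ} (h : x ∈ Icc γ (γ + π)) : 0 ≤ sin (x - γ) :=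
  sin_nonneg_of_nonneg_of_le_pi (by linarith [h.1]) (by linarith [h.2])

namespace Arc

/-- Over `[p, q]` the direction angle of `f` moves in the direction of the sign `ε` (`1` for left,
`-1` for right) and by at most `π`, that is, this part of `f` is a c-curve or a point. -/
structure TurnsMonotonically (f : Arc) (ε p q : ℝ) : Prop where
  monotoneOn : MonotoneOn (fun t => ε * f.angle t) (Icc p q)
  abs_le_pi : |f.angle q - f.angle p| ≤ π

theorem turnsMonotonically_self (f : Arc) (ε p : ℝ) : f.TurnsMonotonically ε p p :=
  ⟨fun x hx y hy _ => by rw [Icc_self] at hx hy; rw [hx, hy],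
    by rw [sub_self, abs_zero]; exact pi_pos.le⟩

namespace IsCurve

variable {f : Arc} {p q t : ℝ} (hf : f.IsCurve) (hp : f.a ≤ p) (hq : q ≤ f.b)
include hf hp hq

theorem d1_sub (hpq : p < q) (ht : t ∈ Icc p q) : (f.sub p q).d1 t = f.d1 t :=
  ((hf.hasDerivWithinAt (Icc_subset_Icc hp hq ht)).mono (Icc_subset_Icc hp hq)).derivWithin
    (uniqueDiffOn_Icc hpq t ht)

theorem turnRate_sub (ht : t ∈ Ioo p q) : (f.sub p q).turnRate t = f.turnRate t := by
  have hpq := ht.1.trans ht.2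
  have hd1 : (f.sub p q).d1 =ᶠ[nhds t] f.d1 := by
    filter_upwards [Icc_mem_nhds ht.1 ht.2] with x hx using hf.d1_sub hp hq hpq hx
  have hd2 : (f.sub p q).d2 t = f.d2 t := by
    change derivWithin (f.sub p q).d1 (Icc p q) t = derivWithin f.d1 (Icc f.a f.b) t
    rw [derivWithin_of_mem_nhds (Icc_mem_nhds ht.1 ht.2), hd1.deriv_eq,
      derivWithin_of_mem_nhds (Icc_mem_nhds (hp.trans_lt ht.1) (ht.2.trans_le hq))]
  rw [turnRate_eq, turnRate_eq, hd1.eq_of_nhds, hd2]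

theorem turning_sub (hpq : p < q) : (f.sub p q).turning = f.angle q - f.angle p := by
  rw [hf.angle_sub ⟨hp, hpq.le.trans hq⟩ ⟨hp.trans hpq.le, hq⟩]
  change ∫ t in p..q, (f.sub p q).turnRate t = _
  refine intervalIntegral.integral_congr_ae ?_
  filter_upwards [compl_mem_ae_iff.mpr (measure_singleton q)] with t ht ht'
  rw [uIoc_of_le hpq.le] at ht'
  exact hf.turnRate_sub hp hq ⟨ht'.1, ht'.2.lt_of_ne ht⟩

theorem turnsMonotonically_of_sub {ε : ℝ} (hc : (f.sub p q).IsCurve)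
    (hε : ∀ᵐ t ∂volume.restrict (Icc p q), 0 ≤ ε * (f.sub p q).curvature t)
    (hπ : |(f.sub p q).turning| ≤ π) : f.TurnsMonotonically ε p q := by
  have hpq : p < q := hc.lt
  refine ⟨fun x hx y hy hxy => ?_, hf.turning_sub hp hq hpq ▸ hπ⟩
  rw [← sub_nonneg, ← mul_sub, hf.angle_sub (Icc_subset_Icc hp hq hx) (Icc_subset_Icc hp hq hy),
    ← intervalIntegral.integral_const_mul]
  refine intervalIntegral.integral_nonneg_of_ae_restrict hxy ?_
  rw [← restrict_Ioo_eq_restrict_Icc] at hε ⊢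
  refine ae_restrict_of_ae_restrict_of_subset (Ioo_subset_Ioo hx.1 hy.2) ?_
  filter_upwards [hε, ae_restrict_mem measurableSet_Ioo] with t ht htpq
  rw [← hf.turnRate_sub hp hq htpq, turnRate, ← mul_assoc]
  exact mul_nonneg ht (norm_nonneg _)

theorem turnsMonotonically_of_isLeftC_sub (h : (f.sub p q).IsLeftC) :
    f.TurnsMonotonically 1 p q :=
  hf.turnsMonotonically_of_sub hp hq h.1
    (h.2.1.mono fun t ht => (one_mul ((f.sub p q).curvature t)).symm ▸ ht) h.2.2

theorem turnsMonotonically_of_isRightC_sub (h : (f.sub p q).IsRightC) :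
    f.TurnsMonotonically (-1) p q :=
  hf.turnsMonotonically_of_sub hp hq h.1 (h.2.1.mono fun t ht => by linarith) h.2.2

end IsCurve

/-- The direction angle of `f` moves in the direction of the sign `ε` up to the parameter `s`, then
in the opposite direction, each time by at most `π`. -/
structure IsTurningPoint (f : Arc) (ε s : ℝ) : Prop where
  sign : ε = 1 ∨ ε = -1
  mem : s ∈ Icc f.a f.b
  left : f.TurnsMonotonically ε f.a s
  right : f.TurnsMonotonically (-ε) s f.b

theorem IsSCurve.exists_isTurningPoint {f : Arc} (h : f.IsSCurve) :
    ∃ ε s, f.IsTurningPoint ε s := by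
  obtain ⟨hf, hl | hr | ⟨s, hs, ⟨hl, hr⟩ | ⟨hr, hl⟩⟩⟩ := h
  · exact ⟨1, f.b, .inl rfl, hf.right_mem,
      hf.turnsMonotonically_of_isLeftC_sub le_rfl le_rfl hl, f.turnsMonotonically_self _ _⟩
  · exact ⟨-1, f.b, .inr rfl, hf.right_mem,
      hf.turnsMonotonically_of_isRightC_sub le_rfl le_rfl hr, f.turnsMonotonically_self _ _⟩
  · exact ⟨1, s, .inl rfl, Ioo_subset_Icc_self hs,
      hf.turnsMonotonically_of_isLeftC_sub le_rfl hs.2.le hl,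
      hf.turnsMonotonically_of_isRightC_sub hs.1.le le_rfl hr⟩
  · exact ⟨-1, s, .inr rfl, Ioo_subset_Icc_self hs,
      hf.turnsMonotonically_of_isRightC_sub le_rfl hs.2.le hr,
      (neg_neg (1 : ℝ)).symm ▸ hf.turnsMonotonically_of_isLeftC_sub hs.1.le le_rfl hl⟩

namespace IsTurningPoint

variable {f : Arc} {ε s t : ℝ} (h : f.IsTurningPoint ε s)
include h

theorem le_angle (ht : t ∈ Icc f.a f.b) : ε * f.angle t ≤ ε * f.angle s := by
  rcases le_total t s with hts | hst
  · exact h.left.monotoneOn ⟨ht.1, hts⟩ ⟨h.mem.1, le_rfl⟩ hts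
  · have := h.right.monotoneOn ⟨le_rfl, h.mem.2⟩ ⟨hst, ht.2⟩ hst
    linarith

theorem min_angle_le (ht : t ∈ Icc f.a f.b) :
    min (ε * f.angle f.a) (ε * f.angle f.b) ≤ ε * f.angle t := by
  rcases le_total t s with hts | hst
  · exact min_le_of_left_le (h.left.monotoneOn ⟨le_rfl, h.mem.1⟩ ⟨ht.1, hts⟩ ht.1)
  · have := h.right.monotoneOn ⟨hst, ht.2⟩ ⟨h.mem.2, le_rfl⟩ ht.2
    exact min_le_of_right_le (by linarith)

theorem abs_angle_sub_le : |f.angle f.b - f.angle f.a| ≤ π := by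
  have hab := h.mem.1.trans h.mem.2
  have ha := h.le_angle ⟨le_rfl, hab⟩
  have hb := h.le_angle ⟨hab, le_rfl⟩
  have hl := abs_le.mp h.left.abs_le_pi
  have hr := abs_le.mp h.right.abs_le_pi
  refine abs_le.mpr ?_
  rcases h.sign with rfl | rfl <;> constructor <;> linarith

end IsTurningPoint

/-- `f` is a curve from `0` to `1` whose direction angle `f.angle` moves from `α` to `β`; the final
angle is prescribed as a real number, not merely modulo `2π`. -/
structure Connects (f : Arc) (α β : ℝ) : Prop where
  isCurve : f.IsCurve
  toFun_a : f.toFun f.a = 0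
  toFun_b : f.toFun f.b = 1
  angle_a : f.angle f.a = α
  angle_b : f.angle f.b = β

end Arc

/-- The s-curves from `0` to `1` with initial and final directions `e^{iα}` and `e^{iβ}`. -/
abbrev sCurvesBetween (α β : ℝ) : Set Arc :=
  sCurves (0, Complex.exp (α * Complex.I)) (1, Complex.exp (β * Complex.I))

namespace Arc

theorem IsCurve.angle_a_eq {f : Arc} {α : ℝ} (hf : f.IsCurve) (hα : α ∈ Ioc (-π) π)
    (h : f.d1 f.a / ‖f.d1 f.a‖ = Complex.exp (α * Complex.I)) : f.angle f.a = α := by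
  have hpos := hf.norm_d1_pos hf.left_mem
  rw [div_eq_iff (Complex.ofReal_ne_zero.mpr hpos.ne'), mul_comm, Complex.exp_mul_I] at h
  rw [angle_start, h, Complex.arg_mul_cos_add_sin_mul_I hpos hα]

theorem IsCurve.angle_b_eq {f : Arc} {β : ℝ} (hf : f.IsCurve)
    (h : f.d1 f.b / ‖f.d1 f.b‖ = Complex.exp (β * Complex.I)) (hβ : |f.angle f.b - β| < 2 * π) :
    f.angle f.b = β := by
  have hpos := hf.norm_d1_pos hf.right_mem
  refine eq_of_exp_mul_I_eq ?_ hβ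
  rw [← h, eq_div_iff (Complex.ofReal_ne_zero.mpr hpos.ne'), mul_comm]
  exact (hf.d1_eq_norm_mul_exp_angle hf.right_mem).symm

theorem connects_of_mem_sCurvesBetween {f : Arc} {α β : ℝ} (hα : α ∈ Ioc (-π) π) (hβ : β < α)
    (hαβ : α - π < β) (hf : f ∈ sCurvesBetween α β) : f.Connects α β := by
  obtain ⟨hs, ha, hb⟩ := hf
  simp only [tangent, Prod.mk.injEq] at ha hb
  obtain ⟨ε, s, hturn⟩ := hs.exists_isTurningPoint
  have hangle := hs.1.angle_a_eq hα ha.2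
  have habs := abs_le.mp hturn.abs_angle_sub_le
  exact ⟨hs.1, ha.1, hb.1, hangle, hs.1.angle_b_eq hb.2
    (abs_lt.mpr ⟨by linarith, by linarith⟩)⟩

namespace Connects

variable {f : Arc} {α β γ : ℝ} (hf : f.Connects α β) (hb : IntegrableOn f.bend (Icc f.a f.b))
include hf hb

theorem integral_bend_eq_multiplierEnergy_add
    (hθ : ∀ t ∈ Icc f.a f.b, 0 ≤ sin (f.angle t - γ)) (c : ℝ) :
    1 / 4 * ∫ t in f.a..f.b, f.bend t =
      multiplierEnergy α β γ c + ∫ t in f.a..f.b, f.calibrationDefect γ c t := by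
  rw [hf.isCurve.integral_bend_eq hf.isCurve.left_mem hf.isCurve.right_mem hb hf.isCurve.lt.le
    hθ c, hf.toFun_a, hf.toFun_b, hf.angle_a, hf.angle_b, height_one, height_zero, multiplierEnergy]
  ring

theorem le_integral_bend_of_isTurningPoint {ε s : ℝ} (hturn : f.IsTurningPoint ε s)
    (hθ : ∀ t ∈ Icc f.a f.b, f.angle t ∈ Icc γ (γ + π)) (c : ℝ) :
    c * (ε * (2 * sqrtSinIntegral (f.angle s - γ) - sqrtSinIntegral (α - γ)
      - sqrtSinIntegral (β - γ)) + c * sin γ) ≤ 1 / 4 * ∫ t in f.a..f.b, f.bend t := by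
  have hs := hturn.mem
  have hl := hf.isCurve.left_mem
  have hr := hf.isCurve.right_mem
  have hleft := hf.isCurve.le_integral_bend hl hs hb hs.1
    (fun t ht => sin_sub_nonneg_of_mem (hθ t ⟨ht.1, ht.2.trans hs.2⟩)) (-(ε * c))
  have hright := hf.isCurve.le_integral_bend hs hr hb hs.2
    (fun t ht => sin_sub_nonneg_of_mem (hθ t ⟨hs.1.trans ht.1, ht.2⟩)) (ε * c)
  have hadd := intervalIntegral.integral_add_adjacent_intervals
    (hf.isCurve.intervalIntegrable_bend hl hs hb) (hf.isCurve.intervalIntegrable_bend hs hr hb)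
  have hε : (ε * c) ^ 2 = c ^ 2 := by rcases hturn.sign with rfl | rfl <;> ring
  rw [hf.toFun_a, hf.angle_a, height_zero, neg_sq, hε] at hleft
  rw [hf.toFun_b, hf.angle_b, height_one, hε] at hright
  rw [← hadd]
  linarith

variable {c : ℝ} (h : IsMultiplier α β γ c)
include h

theorem multiplierEnergy_lt_of_turning_above {s : ℝ} (hturn : f.IsTurningPoint 1 s)
    (hs : γ + π < f.angle s) : multiplierEnergy α β γ c < 1 / 4 * ∫ t in f.a..f.b, f.bend t := by
  have hβs := (abs_le.mp hturn.right.abs_le_pi).1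
  rw [hf.angle_b] at hβs
  refine lt_of_lt_of_le ?_ (hf.le_integral_bend_of_isTurningPoint (γ := f.angle s - π) hb hturn
    (fun t ht => ?_) c)
  · have hlt := h.lt_of_turning_above (x := f.angle s - π) (by linarith) (by linarith)
    rw [multiplierEnergy, mul_lt_mul_iff_right₀ h.c_pos, sub_sub_cancel]
    linarith
  · have hlow := hturn.min_angle_le ht
    have hhigh := hturn.le_angle ht
    rw [hf.angle_a, hf.angle_b, min_eq_right (by linarith [h.α_pos, h.β_neg])] at hlow
    exact ⟨by linarith, by linarith⟩

theorem multiplierEnergy_lt_of_turning_below {s : ℝ} (hturn : f.IsTurningPoint (-1) s)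
    (hs : f.angle s < γ) : multiplierEnergy α β γ c < 1 / 4 * ∫ t in f.a..f.b, f.bend t := by
  have hαs := (abs_le.mp hturn.left.abs_le_pi).1
  rw [hf.angle_a] at hαs
  refine lt_of_lt_of_le ?_ (hf.le_integral_bend_of_isTurningPoint (γ := f.angle s) hb hturn
    (fun t ht => ?_) c)
  · have hlt := h.lt_of_turning_below (x := f.angle s) (by linarith) hs
    rw [multiplierEnergy, mul_lt_mul_iff_right₀ h.c_pos, sub_self, sqrtSinIntegral_zero]
    linarith
  · have hlow := hturn.min_angle_le ht
    have hhigh := hturn.le_angle ht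
    rw [hf.angle_a, hf.angle_b, min_eq_left (by linarith [h.α_pos, h.β_neg])] at hlow
    exact ⟨by linarith, by linarith⟩

theorem mem_band_or_multiplierEnergy_lt (hs : f.IsSCurve) :
    (∀ t ∈ Icc f.a f.b, f.angle t ∈ Icc γ (γ + π)) ∨
      multiplierEnergy α β γ c < 1 / 4 * ∫ t in f.a..f.b, f.bend t := by
  obtain ⟨ε, s, hturn⟩ := hs.exists_isTurningPoint
  have hα := h.α_pos; have hβ := h.β_neg; have hγ := h.lt_γ; have hγβ := h.γ_le
  refine or_iff_not_imp_right.mpr fun hlt t ht => ?_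
  have hlow := hturn.min_angle_le ht
  have hhigh := hturn.le_angle ht
  rw [hf.angle_a, hf.angle_b] at hlow
  rcases hturn.sign with rfl | rfl
  · have hs : f.angle s ≤ γ + π :=
      not_lt.mp (mt (hf.multiplierEnergy_lt_of_turning_above hb h hturn) hlt)
    rw [min_eq_right (by linarith)] at hlow
    exact ⟨by linarith, by linarith⟩
  · have hs : γ ≤ f.angle s :=
      not_lt.mp (mt (hf.multiplierEnergy_lt_of_turning_below hb h hturn) hlt)
    rw [min_eq_left (by linarith)] at hlow
    exact ⟨by linarith, by linarith⟩

end Connects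

end Arc

/-- The direction angle of rectangular elastica. -/
def elasticaAngle (t : ℝ) : ℝ := π / 2 - 2 * arcsin (cos t / √2)

theorem cos_div_sqrt_two_sq (t : ℝ) : (cos t / √2) ^ 2 = cos t ^ 2 / 2 := by
  rw [div_pow, sq_sqrt (by norm_num)]

theorem abs_cos_div_sqrt_two_lt (t : ℝ) : |cos t / √2| < 1 := by
  rw [← sq_lt_one_iff_abs_lt_one, cos_div_sqrt_two_sq]
  nlinarith [sin_sq_add_cos_sq t, sq_nonneg (sin t)]

theorem sqrt_two_mul_sqrt_one_sub_sq (t : ℝ) :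
    √2 * √(1 - (cos t / √2) ^ 2) = √(1 + sin t ^ 2) := by
  rw [cos_div_sqrt_two_sq, ← sqrt_mul (by norm_num)]
  congr 1
  nlinarith [sin_sq_add_cos_sq t]

theorem hasDerivAt_elasticaAngle (t : ℝ) :
    HasDerivAt elasticaAngle (2 * sin t / √(1 + sin t ^ 2)) t := by
  have hlt := abs_lt.mp (abs_cos_div_sqrt_two_lt t)
  have harcsin := (hasDerivAt_arcsin hlt.1.ne' hlt.2.ne).comp t ((hasDerivAt_cos t).div_const √2)
  refine ((harcsin.const_mul 2).const_sub (π / 2)).congr_deriv ?_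
  rw [← sqrt_two_mul_sqrt_one_sub_sq]
  field_simp

theorem sin_elasticaAngle (t : ℝ) : sin (elasticaAngle t) = sin t ^ 2 := by
  have hlt := abs_lt.mp (abs_cos_div_sqrt_two_lt t)
  rw [elasticaAngle, sin_pi_div_two_sub, cos_two_mul, cos_sq',
    sin_arcsin hlt.1.le hlt.2.le, cos_div_sqrt_two_sq]
  nlinarith [sin_sq_add_cos_sq t]

theorem cos_elasticaAngle (t : ℝ) : cos (elasticaAngle t) = cos t * √(1 + sin t ^ 2) := by
  have hlt := abs_lt.mp (abs_cos_div_sqrt_two_lt t)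
  rw [elasticaAngle, cos_pi_div_two_sub, sin_two_mul, cos_arcsin,
    sin_arcsin hlt.1.le hlt.2.le, ← sqrt_two_mul_sqrt_one_sub_sq]
  have hcos : cos t / √2 * 2 = cos t * √2 := by
    rw [div_mul_eq_mul_div, div_eq_iff (by positivity), mul_assoc, mul_self_sqrt zero_le_two]
  linear_combination √(1 - (cos t / √2) ^ 2) * hcos

theorem hasDerivAt_xi (t : ℝ) : HasDerivAt xi (sin t ^ 2 / √(1 + sin t ^ 2)) t := by
  have hc : Continuous fun r : ℝ => sin r ^ 2 / √(1 + sin r ^ 2) :=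
    Continuous.div (by fun_prop) (by fun_prop) fun r => by positivity
  exact intervalIntegral.integral_hasDerivAt_right (hc.intervalIntegrable _ _)
    hc.stronglyMeasurable.stronglyMeasurableAtFilter hc.continuousAt

/-- The derivative of rectangular elastica. -/
def elasticaDeriv (t : ℝ) : ℂ :=
  (cos t : ℂ) + Complex.I * ((sin t ^ 2 / √(1 + sin t ^ 2) : ℝ) : ℂ)

theorem hasDerivAt_elastica (t : ℝ) : HasDerivAt elastica (elasticaDeriv t) t :=
  (hasDerivAt_sin t).ofReal_comp.add ((hasDerivAt_xi t).ofReal_comp.const_mul Complex.I)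

theorem contDiff_elasticaDeriv : ContDiff ℝ 1 elasticaDeriv := by
  unfold elasticaDeriv
  refine ContDiff.add (Complex.ofRealCLM.contDiff.comp contDiff_cos)
    (contDiff_const.mul (Complex.ofRealCLM.contDiff.comp ?_))
  refine (contDiff_sin.pow 2).div ?_ fun t => by positivity
  exact (contDiff_const.add (contDiff_sin.pow 2)).sqrt fun t => by positivity

theorem elasticaDeriv_eq (t : ℝ) : elasticaDeriv t =
    ((1 / √(1 + sin t ^ 2) : ℝ) : ℂ) * Complex.exp (elasticaAngle t * Complex.I) := by
  have hspeed : √(1 + sin t ^ 2) ≠ 0 := by positivity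
  rw [Complex.exp_mul_I, ← Complex.ofReal_cos, ← Complex.ofReal_sin, sin_elasticaAngle,
    cos_elasticaAngle]
  apply Complex.ext <;>
  · simp only [elasticaDeriv, Complex.add_re, Complex.mul_re, Complex.ofReal_re, Complex.ofReal_im,
      Complex.I_re, Complex.I_im, Complex.add_im, Complex.mul_im]
    field_simp
    ring

/-- The parameter in `[-π, 0]` at which rectangular elastica has direction angle `φ ∈ [0, π]`. -/
def elasticaParam (φ : ℝ) : ℝ := -arccos (√2 * sin (π / 4 - φ / 2))

theorem sq_sqrt_two_mul_sin (φ : ℝ) :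
    (√2 * sin (π / 4 - φ / 2)) ^ 2 = 1 - sin φ := by
  have hdouble := cos_two_mul (π / 4 - φ / 2)
  rw [show 2 * (π / 4 - φ / 2) = π / 2 - φ by ring, cos_pi_div_two_sub, cos_sq'] at hdouble
  rw [mul_pow, sq_sqrt zero_le_two]
  linarith

theorem abs_sqrt_two_mul_sin_le {φ : ℝ} (h : φ ∈ Icc 0 π) :
    |√2 * sin (π / 4 - φ / 2)| ≤ 1 := by
  rw [← sq_le_one_iff_abs_le_one, sq_sqrt_two_mul_sin]
  linarith [sin_nonneg_of_mem_Icc h]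

theorem cos_elasticaParam {φ : ℝ} (h : φ ∈ Icc 0 π) :
    cos (elasticaParam φ) = √2 * sin (π / 4 - φ / 2) := by
  have := abs_le.mp (abs_sqrt_two_mul_sin_le h)
  rw [elasticaParam, cos_neg, cos_arccos this.1 this.2]

theorem sin_elasticaParam (φ : ℝ) : sin (elasticaParam φ) = -√(sin φ) := by
  rw [elasticaParam, sin_neg, sin_arccos, sq_sqrt_two_mul_sin, sub_sub_cancel]

theorem elasticaAngle_elasticaParam {φ : ℝ} (h : φ ∈ Icc 0 π) :
    elasticaAngle (elasticaParam φ) = φ := by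
  rw [elasticaAngle, cos_elasticaParam h, mul_div_cancel_left₀ _ (by positivity),
    arcsin_sin (by linarith [h.2, pi_pos]) (by linarith [h.1, pi_pos])]
  ring

theorem continuous_elasticaParam : Continuous elasticaParam := by
  unfold elasticaParam
  have := continuous_arccos
  fun_prop

theorem elasticaParam_nonpos (φ : ℝ) : elasticaParam φ ≤ 0 :=
  neg_nonpos.mpr (arccos_nonneg _)

theorem neg_pi_le_elasticaParam (φ : ℝ) : -π ≤ elasticaParam φ :=
  neg_le_neg (arccos_le_pi _)

theorem strictAntiOn_elasticaParam : StrictAntiOn elasticaParam (Icc 0 π) := by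
  intro x hx y hy hxy
  refine neg_lt_neg (strictAntiOn_arccos (abs_le.mp (abs_sqrt_two_mul_sin_le hy))
    (abs_le.mp (abs_sqrt_two_mul_sin_le hx)) ?_)
  refine mul_lt_mul_of_pos_left (strictMonoOn_sin ⟨?_, ?_⟩ ⟨?_, ?_⟩ ?_) (by positivity) <;>
    linarith [hx.1, hx.2, hy.1, hy.2, pi_pos]

theorem neg_pi_lt_elasticaParam {φ : ℝ} (h : φ ∈ Ico 0 π) : -π < elasticaParam φ :=
  (neg_pi_le_elasticaParam _).trans_lt
    (strictAntiOn_elasticaParam (Ico_subset_Icc_self h) ⟨pi_pos.le, le_rfl⟩ h.2)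

theorem sqrt_one_add_sin_elasticaParam_sq {φ : ℝ} (h : φ ∈ Icc 0 π) :
    √(1 + sin (elasticaParam φ) ^ 2) = √2 * cos (π / 4 - φ / 2) := by
  have hcos : 0 ≤ cos (π / 4 - φ / 2) :=
    cos_nonneg_of_mem_Icc ⟨by linarith [h.2, pi_pos], by linarith [h.1, pi_pos]⟩
  rw [sqrt_eq_iff_eq_sq (by positivity) (by positivity), sin_elasticaParam, neg_sq,
    sq_sqrt (sin_nonneg_of_mem_Icc h), mul_pow, cos_sq', mul_sub, ← mul_pow, sq_sqrt_two_mul_sin,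
    sq_sqrt zero_le_two]
  ring

theorem hasDerivAt_elasticaParam {φ : ℝ} (h : φ ∈ Ioo 0 π) :
    HasDerivAt elasticaParam (-√(1 + sin (elasticaParam φ) ^ 2) / (2 * √(sin φ))) φ := by
  have hsin := sin_pos_of_mem_Ioo h
  have hlt : |√2 * sin (π / 4 - φ / 2)| < 1 := by
    rw [← sq_lt_one_iff_abs_lt_one, sq_sqrt_two_mul_sin]
    linarith
  have hinner : HasDerivAt (fun φ => √2 * sin (π / 4 - φ / 2))
      (√2 * (cos (π / 4 - φ / 2) * (-(1 / 2)))) φ :=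
    ((((hasDerivAt_id φ).div_const 2).const_sub (π / 4)).sin).const_mul √2
  have harccos := (hasDerivAt_arccos (abs_lt.mp hlt).1.ne' (abs_lt.mp hlt).2.ne).comp φ hinner
  refine harccos.neg.congr_deriv ?_
  rw [sqrt_one_add_sin_elasticaParam_sq (Ioo_subset_Icc_self h), sq_sqrt_two_mul_sin,
    sub_sub_cancel]
  field_simp

theorem xi_elasticaParam_sub {x y : ℝ} (hx : x ∈ Icc 0 π) (hy : y ∈ Icc 0 π) (hxy : x ≤ y) :
    xi (elasticaParam x) - xi (elasticaParam y) =
      1 / 2 * (sqrtSinIntegral y - sqrtSinIntegral x) := by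
  set F : ℝ → ℝ := fun t => xi t + 1 / 2 * sqrtSinIntegral (elasticaAngle t)
  have hF : ∀ t, HasDerivAt F (sin t ^ 2 / √(1 + sin t ^ 2) +
      1 / 2 * (√(sin (elasticaAngle t)) * (2 * sin t / √(1 + sin t ^ 2)))) t := fun t =>
    (hasDerivAt_xi t).add
      (((hasDerivAt_sqrtSinIntegral _).comp t (hasDerivAt_elasticaAngle t)).const_mul _)
  have hle : elasticaParam y ≤ elasticaParam x := strictAntiOn_elasticaParam.antitoneOn hx hy hxy
  have hconst : F (elasticaParam x) = F (elasticaParam y) := by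
    refine constant_of_has_deriv_right_zero (fun t _ => (hF t).continuousAt.continuousWithinAt)
      (fun t ht => (hF t).hasDerivWithinAt.congr_deriv ?_) _ ⟨hle, le_rfl⟩
    have hsin : sin t ≤ 0 := sin_nonpos_of_nonpos_of_neg_pi_le
      (ht.2.le.trans (elasticaParam_nonpos x)) ((neg_pi_le_elasticaParam y).trans ht.1)
    rw [sin_elasticaAngle, sqrt_sq_eq_abs, abs_of_nonpos hsin]
    ring
  simp only [F, elasticaAngle_elasticaParam hx, elasticaAngle_elasticaParam hy] at hconst
  linarith

/-- The elastic c-curve given by a multiplier: a segment of rectangular elastica, scaled by `1 / c`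
and rotated by `γ`, starting at the origin. -/
def elasticArc (α β γ c : ℝ) : Arc where
  a := elasticaParam (α - γ)
  b := elasticaParam (β - γ)
  toFun t := Complex.exp (γ * Complex.I) / c * (elastica t - elastica (elasticaParam (α - γ)))

theorem sin_nonpos_of_mem_elasticArc {α β γ c t : ℝ}
    (ht : t ∈ Icc (elasticArc α β γ c).a (elasticArc α β γ c).b) : sin t ≤ 0 :=
  sin_nonpos_of_nonpos_of_neg_pi_le (ht.2.trans (elasticaParam_nonpos _))
    ((neg_pi_le_elasticaParam _).trans ht.1)

namespace IsMultiplier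

open Arc

variable {α β γ c t : ℝ} (h : IsMultiplier α β γ c)
include h

theorem β_lt_α : β < α := h.β_neg.trans h.α_pos

theorem α_sub_mem : α - γ ∈ Icc 0 π :=
  ⟨by linarith [h.γ_le, h.β_lt_α], by linarith [h.lt_γ]⟩

theorem β_sub_mem : β - γ ∈ Icc 0 π :=
  ⟨by linarith [h.γ_le], by linarith [h.lt_γ, h.β_lt_α]⟩

theorem elasticArc_lt : (elasticArc α β γ c).a < (elasticArc α β γ c).b :=
  strictAntiOn_elasticaParam h.β_sub_mem h.α_sub_mem
    (by linarith [h.β_lt_α])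

theorem hasDerivAt_elasticArc (t : ℝ) :
    HasDerivAt (elasticArc α β γ c).toFun (((1 / √(1 + sin t ^ 2) / c : ℝ) : ℂ) *
      Complex.exp ((elasticaAngle t + γ : ℝ) * Complex.I)) t := by
  have hc : (c : ℂ) ≠ 0 := Complex.ofReal_ne_zero.mpr h.c_pos.ne'
  refine (((hasDerivAt_elastica t).sub_const _).const_mul _).congr_deriv ?_
  rw [elasticaDeriv_eq, Complex.ofReal_add, add_mul, Complex.exp_add, Complex.ofReal_div _ c]
  field_simp

theorem contDiffOn_d1_elasticArc : ContDiffOn ℝ 1 (elasticArc α β γ c).d1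
    (Icc (elasticArc α β γ c).a (elasticArc α β γ c).b) := by
  have hcd : ContDiff ℝ 1 fun t => Complex.exp (γ * Complex.I) / c * elasticaDeriv t :=
    contDiff_const.mul contDiff_elasticaDeriv
  refine hcd.contDiffOn.congr fun t ht => ?_
  exact (((hasDerivAt_elastica t).sub_const _).const_mul _).hasDerivWithinAt.derivWithin
    (uniqueDiffOn_Icc h.elasticArc_lt t ht)

theorem elastica_sub_elastica :
    elastica (elasticaParam (β - γ)) - elastica (elasticaParam (α - γ)) =
      c * Complex.exp (-(γ * Complex.I)) := by
  have hxi := xi_elasticaParam_sub h.β_sub_mem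
    h.α_sub_mem (by linarith [h.β_lt_α])
  rw [← h.sin_eq] at hxi
  have hcos := h.cos_eq
  rw [← neg_mul, ← Complex.ofReal_neg, Complex.exp_mul_I, ← Complex.ofReal_cos,
    ← Complex.ofReal_sin, cos_neg, sin_neg]
  apply Complex.ext <;>
  · simp only [elastica, sin_elasticaParam, Complex.sub_re, Complex.add_re, Complex.mul_re,
      Complex.sub_im, Complex.add_im, Complex.mul_im, Complex.ofReal_re, Complex.ofReal_im,
      Complex.I_re, Complex.I_im]
    linarith

theorem toFun_elasticArc_b : (elasticArc α β γ c).toFun (elasticArc α β γ c).b = 1 := by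
  have hc : (c : ℂ) ≠ 0 := Complex.ofReal_ne_zero.mpr h.c_pos.ne'
  have hγ := Complex.exp_ne_zero (γ * Complex.I)
  simp only [elasticArc]
  rw [h.elastica_sub_elastica, Complex.exp_neg]
  field_simp

theorem directlySimilar_elasticArc :
    (elasticaSegment (elasticaParam (α - γ)) (elasticaParam (β - γ))).DirectlySimilar
      (elasticArc α β γ c) := by
  have hc : (c : ℂ) ≠ 0 := Complex.ofReal_ne_zero.mpr h.c_pos.ne'
  have hγ := Complex.exp_ne_zero (γ * Complex.I)
  have himage : (elasticArc α β γ c).similarityMap (c / Complex.exp (γ * Complex.I))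
      (elastica (elasticaParam (α - γ))) =
      elasticaSegment (elasticaParam (α - γ)) (elasticaParam (β - γ)) := by
    simp only [similarityMap, elasticaSegment, elasticArc, Arc.mk.injEq, true_and]
    funext t
    field_simp
    ring
  refine ⟨c / Complex.exp (γ * Complex.I), elastica (elasticaParam (α - γ)), div_ne_zero hc hγ, ?_⟩
  rw [himage]
  exact ⟨rfl, fun _ _ => rfl⟩

section

variable (ht : t ∈ Icc (elasticArc α β γ c).a (elasticArc α β γ c).b)
include ht

theorem d1_elasticArc : (elasticArc α β γ c).d1 t = ((1 / √(1 + sin t ^ 2) / c : ℝ) : ℂ) *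
    Complex.exp ((elasticaAngle t + γ : ℝ) * Complex.I) :=
  (h.hasDerivAt_elasticArc t).hasDerivWithinAt.derivWithin (uniqueDiffOn_Icc h.elasticArc_lt t ht)

theorem norm_d1_elasticArc : ‖(elasticArc α β γ c).d1 t‖ = 1 / √(1 + sin t ^ 2) / c := by
  have hc := h.c_pos
  rw [h.d1_elasticArc ht, norm_mul, Complex.norm_exp_ofReal_mul_I, mul_one, Complex.norm_real,
    norm_of_nonneg (by positivity)]

theorem direction_elasticArc : (elasticArc α β γ c).d1 t / ‖(elasticArc α β γ c).d1 t‖ =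
    Complex.exp ((elasticaAngle t + γ : ℝ) * Complex.I) := by
  have hc := h.c_pos
  have hspeed : ((1 / √(1 + sin t ^ 2) / c : ℝ) : ℂ) ≠ 0 :=
    Complex.ofReal_ne_zero.mpr (by positivity)
  rw [h.norm_d1_elasticArc ht, h.d1_elasticArc ht, mul_div_cancel_left₀ _ hspeed]

end

theorem isCurve_elasticArc : (elasticArc α β γ c).IsCurve where
  lt := h.elasticArc_lt
  differentiableOn t _ := (h.hasDerivAt_elasticArc t).differentiableAt.differentiableWithinAt
  absolutelyContinuous := by
    refine ContDiffOn.absolutelyContinuousOnInterval ?_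
    rw [uIcc_of_le h.elasticArc_lt.le]
    exact h.contDiffOn_d1_elasticArc
  d1_ne_zero t ht := by
    have hc := h.c_pos
    rw [← norm_ne_zero_iff, h.norm_d1_elasticArc ht]
    positivity

theorem tangent_elasticArc_a : (elasticArc α β γ c).tangent (elasticArc α β γ c).a =
    (0, Complex.exp (α * Complex.I)) := by
  rw [tangent, h.direction_elasticArc h.isCurve_elasticArc.left_mem]
  simp only [elasticArc, elasticaAngle_elasticaParam h.α_sub_mem, sub_add_cancel, sub_self,
    mul_zero]

theorem tangent_elasticArc_b : (elasticArc α β γ c).tangent (elasticArc α β γ c).b =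
    (1, Complex.exp (β * Complex.I)) := by
  rw [tangent, h.direction_elasticArc h.isCurve_elasticArc.right_mem, h.toFun_elasticArc_b]
  simp only [elasticArc, elasticaAngle_elasticaParam h.β_sub_mem, sub_add_cancel]

section

variable (ht : t ∈ Icc (elasticArc α β γ c).a (elasticArc α β γ c).b)
include ht

theorem turnRate_elasticArc :
    (elasticArc α β γ c).turnRate t = 2 * sin t / √(1 + sin t ^ 2) := by
  have hd := ((hasDerivAt_elasticaAngle t).add_const γ).hasDerivWithinAt
    (s := Icc (elasticArc α β γ c).a (elasticArc α β γ c).b)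
  rw [turnRate, curvature_mul_speed h.isCurve_elasticArc (τ := fun t => elasticaAngle t + γ)
    (fun s hs => by rw [h.norm_d1_elasticArc hs, h.d1_elasticArc hs]) ht
    (h.contDiffOn_d1_elasticArc.differentiableOn one_ne_zero t ht) hd.differentiableWithinAt]
  exact hd.derivWithin (uniqueDiffOn_Icc h.elasticArc_lt t ht)

theorem curvature_elasticArc : (elasticArc α β γ c).curvature t = 2 * c * sin t := by
  have hc := h.c_pos
  have hturn := h.turnRate_elasticArc ht
  rw [turnRate, h.norm_d1_elasticArc ht] at hturn
  field_simp at hturn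
  linarith

theorem angle_elasticArc : (elasticArc α β γ c).angle t = elasticaAngle t + γ := by
  have hf := h.isCurve_elasticArc
  have ha : (elasticArc α β γ c).angle (elasticArc α β γ c).a = α :=
    hf.angle_a_eq ⟨by linarith [h.α_pos, pi_pos], by linarith [h.lt_γ, h.γ_le, h.β_neg]⟩
      (congrArg Prod.snd h.tangent_elasticArc_a)
  have hint : ∫ r in (elasticArc α β γ c).a..t, (elasticArc α β γ c).turnRate r =
      elasticaAngle t - elasticaAngle (elasticArc α β γ c).a := by
    rw [intervalIntegral.integral_congr fun r hr => h.turnRate_elasticArc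
      (uIcc_subset_Icc hf.left_mem ht hr)]
    refine intervalIntegral.integral_eq_sub_of_hasDerivAt (fun r _ => hasDerivAt_elasticaAngle r) ?_
    exact (Continuous.div (by fun_prop) (by fun_prop) fun r => by positivity).intervalIntegrable _ _
  have hsub := hf.angle_sub hf.left_mem ht
  rw [hint, ha, elasticArc, elasticaAngle_elasticaParam h.α_sub_mem] at hsub
  rw [elasticArc]
  linarith

theorem sin_angle_elasticArc_sub : sin ((elasticArc α β γ c).angle t - γ) = sin t ^ 2 := by
  rw [h.angle_elasticArc ht, add_sub_cancel_right, sin_elasticaAngle]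

theorem calibrationDefect_elasticArc : (elasticArc α β γ c).calibrationDefect γ c t = 0 := by
  rw [calibrationDefect, h.curvature_elasticArc ht, h.sin_angle_elasticArc_sub ht, sqrt_sq_eq_abs,
    abs_of_nonpos (sin_nonpos_of_mem_elasticArc ht)]
  ring

end

theorem connects_elasticArc : (elasticArc α β γ c).Connects α β where
  isCurve := h.isCurve_elasticArc
  toFun_a := congrArg Prod.fst h.tangent_elasticArc_a
  toFun_b := congrArg Prod.fst h.tangent_elasticArc_b
  angle_a := by
    rw [h.angle_elasticArc h.isCurve_elasticArc.left_mem, elasticArc,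
      elasticaAngle_elasticaParam h.α_sub_mem, sub_add_cancel]
  angle_b := by
    rw [h.angle_elasticArc h.isCurve_elasticArc.right_mem, elasticArc,
      elasticaAngle_elasticaParam h.β_sub_mem, sub_add_cancel]

theorem isRightC_elasticArc : (elasticArc α β γ c).IsRightC := by
  have hf := h.connects_elasticArc
  refine ⟨hf.isCurve, ?_, ?_⟩
  · refine ae_restrict_of_forall_mem measurableSet_Icc fun t ht => ?_
    rw [h.curvature_elasticArc ht]
    exact mul_nonpos_of_nonneg_of_nonpos (by linarith [h.c_pos]) (sin_nonpos_of_mem_elasticArc ht)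
  · have hturning := hf.isCurve.angle_sub hf.isCurve.left_mem hf.isCurve.right_mem
    rw [hf.angle_a, hf.angle_b] at hturning
    change |∫ t in _.._, (elasticArc α β γ c).turnRate t| ≤ π
    rw [← hturning, abs_le]
    constructor <;> linarith [h.lt_γ, h.γ_le, h.β_lt_α, pi_pos]

theorem elasticArc_mem_sCurvesBetween : elasticArc α β γ c ∈ sCurvesBetween α β :=
  ⟨⟨h.isCurve_elasticArc, .inr (.inl h.isRightC_elasticArc)⟩, h.tangent_elasticArc_a,
    h.tangent_elasticArc_b⟩

theorem integrableOn_bend_elasticArc : IntegrableOn (elasticArc α β γ c).bend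
    (Icc (elasticArc α β γ c).a (elasticArc α β γ c).b) := by
  have hcont : ContinuousOn (fun t => (2 * c * sin t) ^ 2 * ‖(elasticArc α β γ c).d1 t‖)
      (Icc (elasticArc α β γ c).a (elasticArc α β γ c).b) :=
    ContinuousOn.mul (by fun_prop) h.isCurve_elasticArc.continuousOn_d1.norm
  exact (hcont.congr fun t ht => by rw [bend, h.curvature_elasticArc ht]).integrableOn_Icc

theorem energy_elasticArc :
    (elasticArc α β γ c).energy = ENNReal.ofReal (multiplierEnergy α β γ c) := by
  have hf := h.connects_elasticArc
  have hb := h.integrableOn_bend_elasticArc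
  have hdefect : ∫ t in (elasticArc α β γ c).a..(elasticArc α β γ c).b,
      (elasticArc α β γ c).calibrationDefect γ c t = 0 := by
    rw [intervalIntegral.integral_congr fun t ht => h.calibrationDefect_elasticArc
      (uIcc_subset_Icc hf.isCurve.left_mem hf.isCurve.right_mem ht), intervalIntegral.integral_zero]
  rw [hf.isCurve.energy_eq hb, hf.integral_bend_eq_multiplierEnergy_add hb (fun t ht => by
    rw [h.sin_angle_elasticArc_sub ht]; positivity) c, hdefect, add_zero]

end IsMultiplier

section

variable {E : Type*} [NormedAddCommGroup E] [NormedSpace ℝ E] [CompleteSpace E] {a b : ℝ}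

theorem hasDerivWithinAt_integral_of_continuousOn_Icc {u : ℝ → E} {t : ℝ}
    (hu : ContinuousOn u (Icc a b)) (ht : t ∈ Icc a b) :
    HasDerivWithinAt (fun x => ∫ r in a..x, u r) (u t) (Icc a b) t :=
  haveI : Fact (t ∈ Icc a b) := ⟨ht⟩
  intervalIntegral.integral_hasDerivWithinAt_right
    ((hu.mono (Icc_subset_Icc_right ht.2)).intervalIntegrable_of_Icc ht.1)
    (hu.stronglyMeasurableAtFilter_nhdsWithin measurableSet_Icc t) (hu t ht)

theorem eqOn_Icc_of_hasDerivAt_Ioo {u v u' : ℝ → E} (hu : ContinuousOn u (Icc a b))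
    (hv : ContinuousOn v (Icc a b)) (hu' : ∀ t ∈ Ioo a b, HasDerivAt u (u' t) t)
    (hv' : ∀ t ∈ Ioo a b, HasDerivAt v (u' t) t) (ha : u a = v a) : EqOn u v (Icc a b) := by
  intro t ht
  have hint := intervalIntegral.integral_eq_sub_of_hasDerivAt_of_le (f' := fun _ => (0 : E)) ht.1
    ((hu.sub hv).mono (Icc_subset_Icc_right ht.2))
    (fun x hx => by
      have hx' : x ∈ Ioo a b := ⟨hx.1, hx.2.trans_le ht.2⟩
      simpa only [sub_self] using (hu' x hx').sub (hv' x hx'))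
    intervalIntegrable_const
  rw [intervalIntegral.integral_zero, Pi.sub_apply, Pi.sub_apply, ha, sub_self, sub_zero] at hint
  exact sub_eq_zero.mp hint.symm

end

namespace Arc

namespace IsCurve

variable {f g : Arc} (hf : f.IsCurve)
include hf

theorem hasDerivWithinAt_arclength {t : ℝ} (ht : t ∈ Icc f.a f.b) :
    HasDerivWithinAt f.arclength ‖f.d1 t‖ (Icc f.a f.b) t :=
  hasDerivWithinAt_integral_of_continuousOn_Icc hf.continuousOn_d1.norm ht

theorem continuousOn_arclength : ContinuousOn f.arclength (Icc f.a f.b) :=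
  fun _ ht => (hf.hasDerivWithinAt_arclength ht).continuousWithinAt

theorem hasDerivAt_arclength {t : ℝ} (ht : t ∈ Ioo f.a f.b) :
    HasDerivAt f.arclength ‖f.d1 t‖ t :=
  (hf.hasDerivWithinAt_arclength (Ioo_subset_Icc_self ht)).hasDerivAt (Icc_mem_nhds ht.1 ht.2)

theorem strictMonoOn_arclength : StrictMonoOn f.arclength (Icc f.a f.b) := by
  refine strictMonoOn_of_deriv_pos (convex_Icc _ _) hf.continuousOn_arclength fun t ht => ?_
  rw [interior_Icc] at ht
  exact (hf.hasDerivAt_arclength ht).deriv ▸ hf.norm_d1_pos (Ioo_subset_Icc_self ht)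

theorem unitSpeed_arclength {t : ℝ} (ht : t ∈ Icc f.a f.b) :
    f.unitSpeed (f.arclength t) = f.toFun t :=
  congrArg f.toFun (hf.strictMonoOn_arclength.injOn.leftInvOn_invFunOn ht)

theorem exists_arclength_eq {s : ℝ} (hs : s ∈ Icc 0 f.len) :
    ∃ t ∈ Icc f.a f.b, f.arclength t = s :=
  intermediate_value_Icc hf.lt.le hf.continuousOn_arclength (by simpa [arclength, len] using hs)

variable {σ σ' : ℝ → ℝ} (hg : g.IsCurve) (hσ : MapsTo σ (Icc f.a f.b) (Icc g.a g.b))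
  (ha : σ f.a = g.a)
include hg hσ ha

theorem arclength_eq_of_comp (hσc : ContinuousOn σ (Icc f.a f.b))
    (hσ' : ∀ t ∈ Ioo f.a f.b, HasDerivAt σ (σ' t) t) (hpos : ∀ t ∈ Ioo f.a f.b, 0 ≤ σ' t)
    (hfun : EqOn f.toFun (g.toFun ∘ σ) (Icc f.a f.b)) :
    EqOn f.arclength (g.arclength ∘ σ) (Icc f.a f.b) := by
  refine eqOn_Icc_of_hasDerivAt_Ioo hf.continuousOn_arclength
    (hg.continuousOn_arclength.comp hσc hσ) (fun t ht => hf.hasDerivAt_arclength ht)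
    (fun t ht => ?_) (by simp [arclength, ha])
  have hIcc := Icc_mem_nhds ht.1 ht.2
  have hσt := hσ (Ioo_subset_Icc_self ht)
  have hd1 : f.d1 t = σ' t • g.d1 (σ t) := (hf.hasDerivAt ht).unique
    ((((hg.hasDerivWithinAt hσt).scomp t (hσ' t ht).hasDerivWithinAt hσ).hasDerivAt
      hIcc).congr_of_eventuallyEq (Filter.eventually_of_mem hIcc hfun))
  rw [hd1, norm_smul, norm_of_nonneg (hpos t ht), mul_comm]
  exact ((hg.hasDerivWithinAt_arclength hσt).comp t (hσ' t ht).hasDerivWithinAt hσ).hasDerivAt hIcc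

theorem equivalent_of_comp (hb : σ f.b = g.b) (hσc : ContinuousOn σ (Icc f.a f.b))
    (hσ' : ∀ t ∈ Ioo f.a f.b, HasDerivAt σ (σ' t) t) (hpos : ∀ t ∈ Ioo f.a f.b, 0 ≤ σ' t)
    (hfun : EqOn f.toFun (g.toFun ∘ σ) (Icc f.a f.b)) : f.Equivalent g := by
  have harc := hf.arclength_eq_of_comp hg hσ ha hσc hσ' hpos hfun
  refine ⟨(harc hf.right_mem).trans (congrArg g.arclength hb), fun s hs => ?_⟩
  obtain ⟨t, ht, rfl⟩ := hf.exists_arclength_eq hs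
  calc f.unitSpeed (f.arclength t) = f.toFun t := hf.unitSpeed_arclength ht
    _ = g.toFun (σ t) := hfun ht
    _ = g.unitSpeed (g.arclength (σ t)) := (hg.unitSpeed_arclength (hσ ht)).symm
    _ = g.unitSpeed (f.arclength t) := congrArg g.unitSpeed (harc ht).symm

end IsCurve

/-- The equality case of the calibration: the direction angle stays in `[γ, γ + π]` and the square
`calibrationDefect γ c` vanishes almost everywhere. -/
structure IsCalibrated (f : Arc) (γ c : ℝ) : Prop where
  angle_mem : ∀ t ∈ Icc f.a f.b, f.angle t ∈ Icc γ (γ + π)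
  curvature_eq : ∀ᵐ t, t ∈ Ioc f.a f.b → f.curvature t = -(2 * c * √(sin (f.angle t - γ)))

theorem Connects.isCalibrated {f : Arc} {α β γ c : ℝ} (hf : f.Connects α β)
    (hb : IntegrableOn f.bend (Icc f.a f.b))
    (hθ : ∀ t ∈ Icc f.a f.b, f.angle t ∈ Icc γ (γ + π))
    (hle : 1 / 4 * ∫ t in f.a..f.b, f.bend t ≤ multiplierEnergy α β γ c) :
    f.IsCalibrated γ c := by
  have hsin t (ht : t ∈ Icc f.a f.b) := sin_sub_nonneg_of_mem (hθ t ht)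
  have hab := hf.isCurve.lt.le
  have hzero : ∫ t in f.a..f.b, f.calibrationDefect γ c t = 0 :=
    le_antisymm (by linarith [hf.integral_bend_eq_multiplierEnergy_add hb hsin c])
      (intervalIntegral.integral_nonneg hab fun t _ => f.calibrationDefect_nonneg γ c t)
  rw [intervalIntegral.integral_eq_zero_iff_of_le_of_nonneg_ae hab
    (.of_forall (f.calibrationDefect_nonneg γ c))
    (hf.isCurve.intervalIntegrable_calibrationDefect hf.isCurve.left_mem hf.isCurve.right_mem hb
      hab hsin c), Filter.EventuallyEq, ae_restrict_iff' measurableSet_Ioc] at hzero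
  refine ⟨hθ, ?_⟩
  filter_upwards [hzero] with t hdefect ht
  have hsq := (mul_eq_zero.mp (hdefect ht)).resolve_right
    (hf.isCurve.norm_d1_pos (Ioc_subset_Icc_self ht)).ne'
  linarith [pow_eq_zero_iff two_ne_zero |>.mp hsq]

namespace IsCalibrated

variable {f : Arc} {γ c t : ℝ} (hcal : f.IsCalibrated γ c) (hf : f.IsCurve)
include hcal hf

theorem hasDerivAt_angle (ht : t ∈ Ioo f.a f.b) :
    HasDerivAt f.angle (-(2 * c * √(sin (f.angle t - γ))) * ‖f.d1 t‖) t := by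
  have hcont : ContinuousOn (fun t => -(2 * c * √(sin (f.angle t - γ))) * ‖f.d1 t‖)
      (Icc f.a f.b) :=
    ((hf.continuousOn_sin_angle_sub γ).sqrt.const_mul _).neg.mul hf.continuousOn_d1.norm
  have hint := (hasDerivWithinAt_integral_of_continuousOn_Icc hcont
    (Ioo_subset_Icc_self ht)).const_add (f.d1 f.a).arg
  refine (hint.congr_of_mem (fun x hx => ?_) (Ioo_subset_Icc_self ht)).hasDerivAt
    (Icc_mem_nhds ht.1 ht.2)
  rw [angle]
  congr 1
  refine intervalIntegral.integral_congr_ae ?_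
  filter_upwards [hcal.curvature_eq] with r hr hrx
  rw [uIoc_of_le hx.1] at hrx
  rw [turnRate, hr (Ioc_subset_Ioc_right hx.2 hrx)]

theorem antitoneOn_angle (hc : 0 ≤ c) : AntitoneOn f.angle (Icc f.a f.b) := by
  refine antitoneOn_of_deriv_nonpos (convex_Icc _ _) hf.continuousOn_angle ?_ ?_ <;>
    rw [interior_Icc] <;> intro t ht
  · exact (hcal.hasDerivAt_angle hf ht).differentiableAt.differentiableWithinAt
  · rw [(hcal.hasDerivAt_angle hf ht).deriv, neg_mul]
    exact neg_nonpos.mpr (by positivity)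

end IsCalibrated

/-- The parameter at which rectangular elastica, rotated by `γ`, has the direction of `f` at `t`. -/
def matchingParam (f : Arc) (γ t : ℝ) : ℝ := elasticaParam (f.angle t - γ)

theorem IsCurve.continuousOn_matchingParam {f : Arc} (hf : f.IsCurve) (γ : ℝ) :
    ContinuousOn (f.matchingParam γ) (Icc f.a f.b) :=
  continuous_elasticaParam.comp_continuousOn (hf.continuousOn_angle.sub continuousOn_const)

theorem IsCalibrated.hasDerivAt_matchingParam {f : Arc} {γ c t : ℝ} (hcal : f.IsCalibrated γ c)
    (hf : f.IsCurve) (ht : t ∈ Ioo f.a f.b) (hθ : f.angle t - γ ∈ Ioo 0 π) :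
    HasDerivAt (f.matchingParam γ) (c * √(1 + sin (f.matchingParam γ t) ^ 2) * ‖f.d1 t‖) t := by
  refine ((hasDerivAt_elasticaParam hθ).comp t
    ((hcal.hasDerivAt_angle hf ht).sub_const γ)).congr_deriv ?_
  have hsin : √(sin (f.angle t - γ)) ≠ 0 := (sqrt_pos.mpr (sin_pos_of_mem_Ioo hθ)).ne'
  rw [matchingParam]
  field_simp

theorem IsCurve.toFun_ne_of_angle_eq {f : Arc} {p q θ : ℝ} (hf : f.IsCurve)
    (hp : p ∈ Icc f.a f.b) (hq : q ∈ Icc f.a f.b) (hpq : p < q)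
    (hθ : ∀ t ∈ Icc p q, f.angle t = θ) : f.toFun p ≠ f.toFun q := by
  intro heq
  have hzero := hf.integral_norm_mul_sin (θ - π / 2) hp hq hpq.le
  rw [heq, sub_self] at hzero
  refine hzero.not_gt (intervalIntegral.intervalIntegral_pos_of_pos_on
    (hf.intervalIntegrable_norm_mul_sin _ hp hq) (fun t ht => ?_) hpq)
  rw [hθ t (Ioo_subset_Icc_self ht), sub_sub_cancel, sin_pi_div_two, mul_one]
  exact hf.norm_d1_pos ⟨hp.1.trans ht.1.le, ht.2.le.trans hq.2⟩

end Arc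

namespace IsMultiplier

open Arc

variable {α β γ c : ℝ} {f : Arc} (h : IsMultiplier α β γ c)
include h

section

variable {s t : ℝ} (hf : f.Connects α β) (hcal : f.IsCalibrated γ c)
include hf hcal

theorem angle_mem_of_isCalibrated (ht : t ∈ Icc f.a f.b) : f.angle t ∈ Icc β α := by
  have hanti := hcal.antitoneOn_angle hf.isCurve h.c_pos.le
  exact ⟨hf.angle_b ▸ hanti ht hf.isCurve.right_mem ht.2,
    hf.angle_a ▸ hanti hf.isCurve.left_mem ht ht.1⟩

theorem mapsTo_matchingParam : MapsTo (f.matchingParam γ) (Icc f.a f.b)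
    (Icc (elasticArc α β γ c).a (elasticArc α β γ c).b) := by
  intro t ht
  have hθ := h.angle_mem_of_isCalibrated hf hcal ht
  have hmem : f.angle t - γ ∈ Icc 0 π :=
    ⟨h.β_sub_mem.1.trans (by linarith [hθ.1]), le_trans (by linarith [hθ.2]) h.α_sub_mem.2⟩
  exact ⟨strictAntiOn_elasticaParam.antitoneOn hmem h.α_sub_mem (by linarith [hθ.2]),
    strictAntiOn_elasticaParam.antitoneOn h.β_sub_mem hmem (by linarith [hθ.1])⟩

theorem hasDerivAt_matchingParam (hs : s ≤ f.b) (hβ : ∀ t ∈ Ico f.a s, f.angle t ≠ β)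
    (ht : t ∈ Ioo f.a s) : HasDerivAt (f.matchingParam γ)
      (c * √(1 + sin (f.matchingParam γ t) ^ 2) * ‖f.d1 t‖) t := by
  have hab := Ioo_subset_Ioo_right hs ht
  have hθ := h.angle_mem_of_isCalibrated hf hcal (Ioo_subset_Icc_self hab)
  have hlt : β < f.angle t := hθ.1.lt_of_ne (hβ t (Ioo_subset_Ico_self ht)).symm
  exact hcal.hasDerivAt_matchingParam hf.isCurve hab
    ⟨by linarith [h.γ_le], by linarith [h.lt_γ, hθ.2]⟩

theorem eqOn_elasticArc_comp_matchingParam (hs : s ≤ f.b)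
    (hβ : ∀ t ∈ Ico f.a s, f.angle t ≠ β) :
    EqOn f.toFun ((elasticArc α β γ c).toFun ∘ f.matchingParam γ) (Icc f.a s) := by
  have hsub : Icc f.a s ⊆ Icc f.a f.b := Icc_subset_Icc_right hs
  refine eqOn_Icc_of_hasDerivAt_Ioo (u' := f.d1)
    (hf.isCurve.differentiableOn.continuousOn.mono hsub)
    (h.isCurve_elasticArc.differentiableOn.continuousOn.comp
      ((hf.isCurve.continuousOn_matchingParam γ).mono hsub)
      ((h.mapsTo_matchingParam hf hcal).mono_left hsub))
    (fun t ht => hf.isCurve.hasDerivAt (Ioo_subset_Ioo_right hs ht)) (fun t ht => ?_) ?_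
  · have htab := hsub (Ioo_subset_Icc_self ht)
    refine ((h.hasDerivAt_elasticArc _).scomp t
      (h.hasDerivAt_matchingParam hf hcal hs hβ ht)).congr_deriv ?_
    have hθ := hcal.angle_mem t htab
    have hangle : elasticaAngle (f.matchingParam γ t) + γ = f.angle t := by
      rw [matchingParam, elasticaAngle_elasticaParam ⟨by linarith [hθ.1], by linarith [hθ.2]⟩,
        sub_add_cancel]
    have hspeed : c * √(1 + sin (f.matchingParam γ t) ^ 2) * ‖f.d1 t‖ *
        (1 / √(1 + sin (f.matchingParam γ t) ^ 2) / c) = ‖f.d1 t‖ := by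
      have hc := h.c_pos
      field_simp
    rw [hangle, Complex.real_smul, ← mul_assoc, ← Complex.ofReal_mul, hspeed,
      ← hf.isCurve.d1_eq_norm_mul_exp_angle htab]
  · rw [Function.comp_apply, matchingParam, hf.angle_a, hf.toFun_a]
    simp [elasticArc]

theorem angle_ne_of_isCalibrated (ht : t ∈ Ico f.a f.b) : f.angle t ≠ β := by
  intro heq
  have hβ_closed : IsClosed (Icc f.a f.b ∩ f.angle ⁻¹' {β}) :=
    hf.isCurve.continuousOn_angle.preimage_isClosed_of_isClosed isClosed_Icc isClosed_singleton
  obtain ⟨s, ⟨hs, hsβ⟩, hleast⟩ :=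
    (isCompact_Icc.of_isClosed_subset hβ_closed inter_subset_left).exists_isLeast
      ⟨t, Ico_subset_Icc_self ht, heq⟩
  have hsb : s < f.b := (hleast ⟨Ico_subset_Icc_self ht, heq⟩).trans_lt ht.2
  have hbefore r (hr : r ∈ Ico f.a s) : f.angle r ≠ β := fun hrβ =>
    hr.2.not_ge (hleast ⟨⟨hr.1, hr.2.le.trans hs.2⟩, hrβ⟩)
  have hafter r (hr : r ∈ Icc s f.b) : f.angle r = β := by
    have hrab : r ∈ Icc f.a f.b := ⟨hs.1.trans hr.1, hr.2⟩
    exact le_antisymm (hsβ ▸ hcal.antitoneOn_angle hf.isCurve h.c_pos.le hs hrab hr.1)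
      (h.angle_mem_of_isCalibrated hf hcal hrab).1
  have hs_end : f.toFun s = 1 := by
    rw [h.eqOn_elasticArc_comp_matchingParam hf hcal hs.2 hbefore (right_mem_Icc.mpr hs.1),
      Function.comp_apply, matchingParam, hsβ]
    exact h.toFun_elasticArc_b
  exact hf.isCurve.toFun_ne_of_angle_eq hs hf.isCurve.right_mem hsb hafter
    (hs_end.trans hf.toFun_b.symm)

theorem equivalent_elasticArc : f.Equivalent (elasticArc α β γ c) := by
  have hβ t (ht : t ∈ Ico f.a f.b) := h.angle_ne_of_isCalibrated hf hcal ht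
  have hc := h.c_pos
  refine hf.isCurve.equivalent_of_comp h.isCurve_elasticArc (h.mapsTo_matchingParam hf hcal) ?_ ?_
    (hf.isCurve.continuousOn_matchingParam γ)
    (fun t ht => h.hasDerivAt_matchingParam hf hcal le_rfl hβ ht) (fun t _ => by positivity)
    (h.eqOn_elasticArc_comp_matchingParam hf hcal le_rfl hβ)
  · rw [matchingParam, hf.angle_a, elasticArc]
  · rw [matchingParam, hf.angle_b, elasticArc]

end

theorem connects_of_mem (hf : f ∈ sCurvesBetween α β) : f.Connects α β :=
  connects_of_mem_sCurvesBetween ⟨by linarith [h.α_pos, pi_pos], by linarith [h.lt_γ, h.γ_le,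
    h.β_neg]⟩ h.β_lt_α (h.lt_γ.trans_le h.γ_le) hf

theorem multiplierEnergy_nonneg : 0 ≤ multiplierEnergy α β γ c := by
  have hsin : 0 ≤ -sin γ := by
    rw [← sin_neg]
    exact sin_nonneg_of_nonneg_of_le_pi (by linarith [h.γ_le, h.β_neg])
      (by linarith [h.lt_γ, h.α_pos])
  have heq : multiplierEnergy α β γ c = c ^ 2 * -sin γ := by
    rw [multiplierEnergy]
    linear_combination (-2 * c) * h.sin_eq
  rw [heq]
  positivity

theorem multiplierEnergy_le (hf : f ∈ sCurvesBetween α β)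
    (hb : IntegrableOn f.bend (Icc f.a f.b)) :
    multiplierEnergy α β γ c ≤ 1 / 4 * ∫ t in f.a..f.b, f.bend t := by
  have hconn := h.connects_of_mem hf
  rcases hconn.mem_band_or_multiplierEnergy_lt hb h hf.1 with hband | hlt
  · rw [hconn.integral_bend_eq_multiplierEnergy_add hb
      (fun t ht => sin_sub_nonneg_of_mem (hband t ht)) c]
    exact le_add_of_nonneg_right (intervalIntegral.integral_nonneg hconn.isCurve.lt.le
      fun t _ => f.calibrationDefect_nonneg γ c t)
  · exact hlt.le

theorem hasMinimalEnergy_elasticArc :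
    HasMinimalEnergy (sCurvesBetween α β) (elasticArc α β γ c) := by
  refine ⟨h.elasticArc_mem_sCurvesBetween, fun g hg => ?_⟩
  by_cases hfinite : g.energy = ⊤
  · exact hfinite ▸ le_top
  have hcurve := (h.connects_of_mem hg).isCurve
  have hb := hcurve.integrableOn_bend hfinite
  rw [h.energy_elasticArc, hcurve.energy_eq hb]
  exact ENNReal.ofReal_le_ofReal (h.multiplierEnergy_le hg hb)

theorem equivalent_of_hasMinimalEnergy (hf : HasMinimalEnergy (sCurvesBetween α β) f) :
    f.Equivalent (elasticArc α β γ c) := by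
  have hconn := h.connects_of_mem hf.1
  have hle := h.energy_elasticArc ▸ hf.2 _ h.elasticArc_mem_sCurvesBetween
  have hb := hconn.isCurve.integrableOn_bend (ne_top_of_le_ne_top ENNReal.ofReal_ne_top hle)
  rw [hconn.isCurve.energy_eq hb, ENNReal.ofReal_le_ofReal_iff h.multiplierEnergy_nonneg] at hle
  have hband := (hconn.mem_band_or_multiplierEnergy_lt hb h hf.1.1).resolve_right hle.not_gt
  exact h.equivalent_elasticArc hconn (hconn.isCalibrated hb hband hle)

end IsMultiplier

end ElasticSpline

end

theorem theorem6p2 (α β : ℝ) (hα : α ∈ Set.Ioo 0 Real.pi) (hβ : β < 0) (hβα : |β| ≤ α)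
    (hαβ : α - Real.pi < β) (hσ : ElasticSpline.sigma α β β ≤ 0) :
    ∃ t₁ t₂ : ℝ, -Real.pi < t₁ ∧ t₁ < t₂ ∧ t₂ ≤ 0 ∧
      ∃ f ∈ ElasticSpline.sCurves (0, Complex.exp (α * Complex.I)) (1, Complex.exp (β * Complex.I)),
        (ElasticSpline.elasticaSegment t₁ t₂).DirectlySimilar f ∧
        ElasticSpline.Arc.HasMinimalEnergy
          (ElasticSpline.sCurves (0, Complex.exp (α * Complex.I)) (1, Complex.exp (β * Complex.I))) f ∧
        ∀ g, ElasticSpline.Arc.HasMinimalEnergy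
          (ElasticSpline.sCurves (0, Complex.exp (α * Complex.I)) (1, Complex.exp (β * Complex.I))) g →
          g.Equivalent f := by
  obtain ⟨γ, c, h⟩ := ElasticSpline.exists_isMultiplier hβ ((neg_le_abs β).trans hβα) hαβ hα.2 hσ
  exact ⟨ElasticSpline.elasticaParam (α - γ), ElasticSpline.elasticaParam (β - γ),
    ElasticSpline.neg_pi_lt_elasticaParam ⟨h.α_sub_mem.1, by linarith [h.lt_γ]⟩,
    h.elasticArc_lt, ElasticSpline.elasticaParam_nonpos _,
    ElasticSpline.elasticArc α β γ c, h.elasticArc_mem_sCurvesBetween,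
    h.directlySimilar_elasticArc, h.hasMinimalEnergy_elasticArc,
    fun _ hg => h.equivalent_of_hasMinimalEnergy hg⟩
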